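/- \textbf{Setting.} Let $q\ge 2$, let $a\in\mathbb{R}_{\ge 0}^q$ be an activity vector, let $\xi_1,\dots,\xi_q$ be random vectors in $\mathbb{R}^q$, and let $X_0\in\mathbb{R}_{\ge0}^q$ be deterministic with $a\cdot X_0>0$. The generalized P\'olya urn $(X_n)_{n\ge 0}$ is the process started at $X_0$ in which, given $X_0,\dots,X_n$ and with $S_n:=a\cdot X_n$: if $S_n>0$, a type $i$ is selected with probability $a_iX_{n,i}/S_n$, and then $X_{n+1}-X_n$ is distributed as $\xi_i$, independently of the past; if $S_n=0$, then $X_{n+1}=X_n$. Let $\mathcal{E}_n^c:=\{S_k>0 \text{ for all } 0\le k\le n\}$ be the event of non-extinction up to time $n$ and $\mathcal{E}_\infty^c:=\bigcap_n\mathcal{E}_n^c$ the event of non-extinction. Let $A:=(a_j\mathbb{E}\,\xi_{j,i})_{i,j=1}^q$, with eigenvalues $\lambda_1,\dots,\lambda_q\in\mathbb{C}$, counted with algebraic multiplicity and ordered so that $\Re\lambda_1\ge\dots\ge\Re\lambda_q$. \textbf{Theorem.} Assume that (1) the urn is tenable, i.e. almost surely all coordinates of $X_n$ are non-negative for every $n$;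 (2) the urn is balanced in expectation: there is $b>0$ such that $\sum_{j}a_j\mathbb{E}\,\xi_{i,j}=b$ for every $i$ with $a_i>0$; (3) $\lambda_1=b$, and $\mathbb{E}|\xi_i|^p<\infty$ for all $i$ and all $p\ge2$; (4) the urn is strictly small, i.e. $\lambda_1>2\,\Re\lambda_2$. Let $\Sigma$ be a positive semidefinite real $q\times q$ matrix, put $Y_n:=\big(X_n-\mathbb{E}[X_n\mid\mathcal{E}_n^c]\big)/\sqrt n$, and suppose that, conditioned on non-extinction, $Y_n\to\mathcal{N}(0,\Sigma)$ in distribution, either with respect to the conditional probabilities $\mathbb{P}(\,\cdot\mid\mathcal{E}_n^c)$ or with respect to $\mathbb{P}(\,\cdot\mid\mathcal{E}_\infty^c)$. Then, with respect to both $\mathbb{P}(\,\cdot\mid\mathcal{E}_n^c)$ and $\mathbb{P}(\,\cdot\mid\mathcal{E}_\infty^c)$, this convergence in distribution holds with convergence of all conditional moments: with $N\sim\mathcal{N}(0,\Sigma)$, all the conditional moments below are finite, and as $n\to\infty$ \[\mathbb{E}\Big[\prod_{i}Y_{n,i}^{\alpha_i}\,\Big|\,\mathcal{E}_n^c\Big]\to\mathbb{E}\prod_i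 N_i^{\alpha_i}\quad(\alpha\in\mathbb{Z}_{\ge0}^q),\qquad \mathbb{E}\big[|Y_n|^r\,\big|\,\mathcal{E}_n^c\big]\to\mathbb{E}|N|^r\quad(r>0),\] and likewise with $\mathcal{E}_\infty^c$ in place of $\mathcal{E}_n^c$ as the conditioning event. In particular, $\mathrm{Cov}[X_n\mid\mathcal{E}_n^c]/n\to\Sigma$ as $n\to\infty$. -/

import Mathlib

open MeasureTheory ProbabilityTheory Filter
open scoped Topology BoundedContinuousFunction

/-- The data of a generalized Polya urn with `q` types: activities `a i ≥ 0`, the law of the random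
replacement vector `ξ i` for each type `i`, and a deterministic non-negative initial composition
of positive total activity. -/
structure PolyaUrn (q : ℕ) where
  activity : Fin q → ℝ
  activity_nonneg : ∀ i, 0 ≤ activity i
  replacement : Fin q → ProbabilityMeasure (EuclideanSpace ℝ (Fin q))
  init : EuclideanSpace ℝ (Fin q)
  init_nonneg : ∀ i, 0 ≤ init i
  init_total_pos : 0 < ∑ i, activity i * init i

namespace PolyaUrn

variable {q : ℕ} (U : PolyaUrn q)

/-- The total activity `a · x` of a composition `x`. -/
noncomputable def totalActivity (x : EuclideanSpace ℝ (Fin q)) : ℝ :=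
  ∑ i, U.activity i * x i

/-- The expected replacement vector: entry `j` of `E ξ_i`. -/
noncomputable def meanReplacement (i j : Fin q) : ℝ :=
  ∫ x, x j ∂(U.replacement i : Measure (EuclideanSpace ℝ (Fin q)))

/-- The intensity matrix `A = (a_j E ξ_{j,i})_{i,j}`. -/
noncomputable def intensityMatrix : Matrix (Fin q) (Fin q) ℝ :=
  Matrix.of fun i j => U.activity j * U.meanReplacement j i

/-- `ev` lists the complex eigenvalues of the intensity matrix with algebraic multiplicity,
in decreasing order of their real parts. -/
structure IsEigenvalueOrdering (ev : Fin q → ℂ) : Prop where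
  map_eq : Finset.univ.val.map ev
    = (U.intensityMatrix.map (algebraMap ℝ ℂ)).charpoly.roots
  antitone_re : Antitone fun i => (ev i).re

/-- The conditional law of the increment of the urn, given the history, when the present
composition is `x`: if the total activity is positive, a type `i` is selected with
probability `a_i x_i / (a · x)` and the increment is then distributed as `ξ_i`; otherwise the
increment is zero. The value is the probability of the set `B`. -/
noncomputable def incrementProb (x : EuclideanSpace ℝ (Fin q))
    (B : Set (EuclideanSpace ℝ (Fin q))) : ℝ :=
  open scoped Classical in
  if 0 < U.totalActivity x then
    ∑ i, U.activity i * x i / U.totalActivity x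
      * (U.replacement i : Measure (EuclideanSpace ℝ (Fin q))).real B
  else if (0 : EuclideanSpace ℝ (Fin q)) ∈ B then 1 else 0

/-- `X` is the composition process of the urn `U` on the probability space `(Ω, μ)`: it starts from
the initial composition, and the conditional law of `X (n+1) - X n` given `X 0, …, X n` is the one
described by the urn. -/
structure IsUrnEvolution {Ω : Type*} [MeasurableSpace Ω] (μ : Measure Ω)
    (X : ℕ → Ω → EuclideanSpace ℝ (Fin q)) : Prop where
  measurable : ∀ n, Measurable (X n)
  init_eq : ∀ᵐ ω ∂μ, X 0 ω = U.init
  condLaw : ∀ (n : ℕ) (B : Set (EuclideanSpace ℝ (Fin q))), MeasurableSet B →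
    μ[Set.indicator {ω | X (n + 1) ω - X n ω ∈ B} (fun _ => (1 : ℝ)) |
        Filtration.natural X (fun k => (measurable k).stronglyMeasurable) n]
      =ᵐ[μ] fun ω => U.incrementProb (X n ω) B

/-- Tenability: the composition stays (almost surely) non-negative at every step. -/
def IsTenable {Ω : Type*} [MeasurableSpace Ω] (μ : Measure Ω)
    (X : ℕ → Ω → EuclideanSpace ℝ (Fin q)) : Prop :=
  ∀ n, ∀ᵐ ω ∂μ, ∀ i, 0 ≤ X n ω i

/-- Balanced in expectation with constant `b > 0`. -/
def IsBalancedInExpectation (b : ℝ) : Prop :=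
  0 < b ∧ ∀ i, 0 < U.activity i → ∑ j, U.activity j * U.meanReplacement i j = b

/-- The event of non-extinction up to time `n`. -/
def nonExtinctUpTo {Ω : Type*} (X : ℕ → Ω → EuclideanSpace ℝ (Fin q)) (n : ℕ) : Set Ω :=
  {ω | ∀ k ≤ n, 0 < U.totalActivity (X k ω)}

/-- The event of non-extinction (at all times). -/
def nonExtinct {Ω : Type*} (X : ℕ → Ω → EuclideanSpace ℝ (Fin q)) : Set Ω :=
  ⋂ n, U.nonExtinctUpTo X n

/-- The centred and rescaled composition `(X_n - E[X_n | non-extinction up to time n]) / √n`. -/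
noncomputable def normalized {Ω : Type*} [MeasurableSpace Ω] (μ : Measure Ω)
    (X : ℕ → Ω → EuclideanSpace ℝ (Fin q)) (n : ℕ) (ω : Ω) : EuclideanSpace ℝ (Fin q) :=
  (√(n : ℝ))⁻¹ • (X n ω - ∫ ω', X n ω' ∂μ[|U.nonExtinctUpTo X n])

end PolyaUrn

/-- Convergence in distribution of `Y n`, under the conditional probabilities `μ[|D n]`, to the
centred normal law with covariance matrix `Sig`. -/
def CondTendstoNormal {q : ℕ} {Ω : Type*} [MeasurableSpace Ω] (μ : Measure Ω)
    (D : ℕ → Set Ω) (Y : ℕ → Ω → EuclideanSpace ℝ (Fin q)) (Sig : Matrix (Fin q) (Fin q) ℝ) :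
    Prop :=
  ∀ f : EuclideanSpace ℝ (Fin q) →ᵇ ℝ,
    Tendsto (fun n => ∫ ω, f (Y n ω) ∂μ[|D n]) atTop
      (𝓝 (∫ x, f x ∂multivariateGaussian 0 Sig))

/-- Convergence of all moments of `Y n` under the conditional probabilities `μ[|D n]` to those of
the centred normal law with covariance matrix `Sig`: all these moments are finite, all mixed
moments of the coordinates converge, and so do the absolute moments of every positive order. -/
def CondMomentsTendstoNormal {q : ℕ} {Ω : Type*} [MeasurableSpace Ω] (μ : Measure Ω)
    (D : ℕ → Set Ω) (Y : ℕ → Ω → EuclideanSpace ℝ (Fin q)) (Sig : Matrix (Fin q) (Fin q) ℝ) :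
    Prop :=
  (∀ α : Fin q → ℕ,
    (∀ n, Integrable (fun ω => ∏ i, Y n ω i ^ α i) (μ[|D n])) ∧
    Tendsto (fun n => ∫ ω, ∏ i, Y n ω i ^ α i ∂μ[|D n]) atTop
      (𝓝 (∫ x, ∏ i, x i ^ α i ∂multivariateGaussian 0 Sig))) ∧
  (∀ r : ℝ, 0 < r →
    (∀ n, Integrable (fun ω => ‖Y n ω‖ ^ r) (μ[|D n])) ∧
    Tendsto (fun n => ∫ ω, ‖Y n ω‖ ^ r ∂μ[|D n]) atTop
      (𝓝 (∫ x, ‖x‖ ^ r ∂multivariateGaussian 0 Sig)))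

namespace PolyaUrn

/-- The standing condition with exponent `p`: the urn is tenable and balanced in expectation
with constant `b > 0`, the first eigenvalue equals `b`, and every `ξ_i` has a finite `L^p`
norm. -/
structure StandingCondition {q : ℕ} (U : PolyaUrn q) (hq : 0 < q) {Ω : Type*} [MeasurableSpace Ω]
    (μ : Measure Ω) (X : ℕ → Ω → EuclideanSpace ℝ (Fin q)) (ev : Fin q → ℂ) (b p : ℝ) :
    Prop where
  tenable : IsTenable μ X
  balanced : U.IsBalancedInExpectation b
  first_eigenvalue : ev ⟨0, hq⟩ = b
  memLp : ∀ i, MemLp id (ENNReal.ofReal p)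
    (U.replacement i : Measure (EuclideanSpace ℝ (Fin q)))

end PolyaUrn

/-!
# Moment convergence for strictly small Pólya urns

Convergence in distribution together with uniform bounds on all moments gives convergence of all
moments (`tendsto_integral_of_moment_bound`), so the point is to bound the conditional moments of
the normalized compositions.

The activity vector `a` is a left eigenvector of the intensity matrix `A` for the simple eigenvalue
`b`. Let `v` be the right eigenvector with `a · v = 1`. The urn should follow the line `n ↦ n b v`,
and it suffices to bound the moments of `X n - (n + 1) b v` over the event of survival by powers
of `√n`. On the hyperplane of total activity zero all eigenvalues of `A` have real part less than
`b / 2`, and a quadratic Lyapunov form (`exists_lyapunov_functionals`) turns this into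
`⟪w, A w⟫ ≤ ρ ‖w‖²` with `ρ < b / 2`. From the composition `x` the mean increment is `A x / (a · x)`,
whose denominator is random. Where `a · x` is not much smaller than `b n`, the drift expands the
distance to the line by a factor of at most `1 + κ / n` with `κ < 1 / 2`. Elsewhere `a · x` is
itself far from `b n`. Adding a large multiple of `(a · x)²` to the Lyapunov form therefore gives
one Euclidean norm in which the drift has this bound at every composition
(`PolyaUrn.exists_drift_form`). A Taylor expansion of even powers of this norm along one step
gives `u (n + 1) ≤ (1 + 2 m κ / n) u n + O(n ^ (m - 1))` for the moment of order `2 m`, hence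
`u n = O(n ^ m)` by induction on `m` (`PolyaUrn.exists_moment_bound`).

The same bounds show that the urn dies at time `n` with a probability that decays faster than any
power of `n`. As the mean total activity does not decrease, the urn survives with positive
probability (`PolyaUrn.measureReal_nonExtinct_pos`). Consequently the two conditionings are
asymptotically equivalent (`tendsto_integral_cond_sub`), and bounds over the event of survival
are bounds on conditional moments.
-/

/-! ### A quadratic Lyapunov function for a linear map -/

/-- If all eigenvalues of a complex endomorphism `f` have real part at most `ρ₀ < ρ`, some positive
definite Hermitian form, written as a sum of squares of functionals, satisfies
`Re ⟪x, f x⟫ ≤ ρ ⟪x, x⟫`. The induction on the dimension splits off an eigenfunctional of `f`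
and gives the form already found on its kernel a small weight. -/
theorem exists_lyapunov_functionals {V : Type*} [AddCommGroup V] [Module ℂ V]
    [FiniteDimensional ℂ V] (f : Module.End ℂ V) {ρ₀ ρ : ℝ} (hρ : ρ₀ < ρ)
    (hf : ∀ μ, f.HasEigenvalue μ → μ.re ≤ ρ₀) :
    ∃ (ι : Type) (_ : Fintype ι) (φ : ι → V →ₗ[ℂ] ℂ),
      (∀ x, (∀ i, φ i x = 0) → x = 0) ∧
      ∀ x, ∑ i, ((starRingEnd ℂ) (φ i x) * φ i (f x)).re ≤ ρ * ∑ i, ‖φ i x‖ ^ 2 := by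
  induction hn : Module.finrank ℂ V generalizing V ρ with
  | zero =>
    have : Subsingleton V := Module.finrank_zero_iff.mp hn
    exact ⟨Empty, inferInstance, fun i => i.elim, fun x _ => Subsingleton.elim _ _, by simp⟩
  | succ n ih =>
    have : Nontrivial V := Module.nontrivial_of_finrank_eq_succ hn
    obtain ⟨μ, hμ⟩ := Module.End.exists_eigenvalue f
    -- an eigenfunctional: it vanishes on the range of `f - μ`, which is a proper subspace
    have hrange : LinearMap.range (f - algebraMap ℂ (Module.End ℂ V) μ) ≠ ⊤ := by
      intro htop
      have h1 := LinearMap.ker_eq_bot_iff_range_eq_top.mpr htop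
      rw [Module.End.hasEigenvalue_iff, Module.End.eigenspace_def] at hμ
      exact hμ h1
    obtain ⟨φ, hφ0, hφ⟩ := Submodule.exists_le_ker_of_lt_top _ (lt_top_iff_ne_top.mpr hrange)
    have hφf : ∀ x, φ (f x) = μ * φ x := by
      intro x
      have : (f - algebraMap ℂ (Module.End ℂ V) μ) x ∈ LinearMap.ker φ := hφ ⟨x, rfl⟩
      simpa [sub_eq_zero, Module.algebraMap_end_apply] using this
    obtain ⟨u, hu⟩ : ∃ u, φ u = 1 := by
      obtain ⟨y, hy⟩ : ∃ y, φ y ≠ 0 := by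
        by_contra! h
        exact hφ0 (LinearMap.ext h)
      exact ⟨(φ y)⁻¹ • y, by simp [hy]⟩
    have hinv : ∀ x ∈ LinearMap.ker φ, f x ∈ LinearMap.ker φ := by
      intro x hx
      rw [LinearMap.mem_ker] at hx ⊢
      rw [hφf, hx, mul_zero]
    have hker : Module.finrank ℂ (LinearMap.ker φ) = n := by
      have h1 := LinearMap.finrank_range_add_finrank_ker φ
      have h2 : LinearMap.range φ = ⊤ := LinearMap.range_eq_top.mpr fun z => ⟨z • u, by simp [hu]⟩
      rw [h2, hn, finrank_top, Module.finrank_self] at h1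
      omega
    obtain ⟨ι, _, φ', hφ'inj, hφ'⟩ := ih (ρ := (ρ₀ + ρ) / 2) (f.restrict hinv) (by linarith)
      (by
        intro ν hν
        refine hf ν ?_
        obtain ⟨w, hw⟩ := hν.exists_hasEigenvector
        refine Module.End.hasEigenvalue_of_hasEigenvector (x := (w : V)) ⟨?_, ?_⟩
        · rw [Module.End.mem_eigenspace_iff]
          have := congrArg Subtype.val hw.apply_eq_smul
          simpa using this
        · simpa using hw.2) hker
    -- the projection onto `ker φ` along `u`
    let P : V →ₗ[ℂ] LinearMap.ker φ :=
      (LinearMap.id - φ.smulRight u).codRestrict (LinearMap.ker φ) (by intro x; simp [hu])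
    have hP : ∀ x, (P x : V) = x - φ x • u := fun x => rfl
    let z : LinearMap.ker φ := ⟨f u - μ • u, by simp [hφf, hu]⟩
    have hPf : ∀ x, P (f x) = f.restrict hinv (P x) + φ x • z := by
      intro x
      ext
      simp only [hP, Submodule.coe_add, LinearMap.coe_restrict_apply, Submodule.coe_smul, z, hφf,
        map_sub, map_smul, smul_sub, smul_smul]
      rw [mul_comm μ]
      abel
    set δ := (ρ - ρ₀) / 2 with hδ
    have hδ0 : 0 < δ := by rw [hδ]; linarith
    set Z := ∑ i, ‖φ' i z‖ ^ 2 with hZ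
    have hZ0 : 0 ≤ Z := by positivity
    -- the weight of the form on `ker φ`, small enough to absorb the mixed terms
    set ε := δ / (1 + Z / (4 * δ)) with hε
    have hε0 : 0 < ε := by positivity
    have hεZ : ε * (Z / (4 * δ)) ≤ δ := by
      rw [hε, div_mul_eq_mul_div, div_le_iff₀ (by positivity)]
      nlinarith
    have hsq : √ε ^ 2 = ε := Real.sq_sqrt hε0.le
    have hμ0 := hf μ hμ
    refine ⟨Option ι, inferInstance,
      fun o => o.elim φ fun i => ((√ε : ℝ) : ℂ) • (φ' i ∘ₗ P), ?_, ?_⟩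
    · intro x hx
      have h0 : φ x = 0 := hx none
      have h1 : P x = 0 := by
        apply hφ'inj
        intro i
        have := hx (some i)
        simp only [Option.elim, LinearMap.smul_apply, smul_eq_mul, mul_eq_zero,
          Complex.ofReal_eq_zero, LinearMap.comp_apply] at this
        exact this.resolve_left (Real.sqrt_pos.mpr hε0).ne'
      have := hP x
      simpa [h1, h0, eq_comm] using this
    · intro x
      have key := hφ' (P x)
      rw [Fintype.sum_option, Fintype.sum_option]
      have e1 : ∀ i, ‖((√ε : ℝ) : ℂ) * φ' i (P x)‖ ^ 2 = ε * ‖φ' i (P x)‖ ^ 2 := by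
        intro i
        rw [norm_mul, mul_pow, Complex.norm_real, Real.norm_eq_abs, sq_abs, hsq]
      have e2 : ∀ i, ((starRingEnd ℂ) (((√ε : ℝ) : ℂ) * φ' i (P x)) *
          (((√ε : ℝ) : ℂ) * φ' i (P (f x)))).re
          ≤ ε * ((starRingEnd ℂ) (φ' i (P x)) * φ' i (f.restrict hinv (P x))).re
            + ε * (δ * ‖φ' i (P x)‖ ^ 2 + ‖φ x‖ ^ 2 * ‖φ' i z‖ ^ 2 / (4 * δ)) := by
        intro i
        have h1 : (starRingEnd ℂ) (((√ε : ℝ) : ℂ) * φ' i (P x)) *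
            (((√ε : ℝ) : ℂ) * φ' i (P (f x)))
            = (ε : ℂ) * ((starRingEnd ℂ) (φ' i (P x)) * φ' i (f.restrict hinv (P x))
              + (starRingEnd ℂ) (φ' i (P x)) * (φ x * φ' i z)) := by
          rw [hPf, map_add, map_smul, map_mul, Complex.conj_ofReal, smul_eq_mul]
          have : (ε : ℂ) = (√ε : ℝ) * (√ε : ℝ) := by
            rw [← Complex.ofReal_mul, ← sq, hsq]
          rw [this]
          ring
        rw [h1, Complex.re_ofReal_mul, Complex.add_re, mul_add]
        gcongr
        refine (Complex.re_le_norm _).trans ?_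
        rw [norm_mul, norm_mul, RCLike.norm_conj]
        have h2 : δ * ‖φ' i (P x)‖ ^ 2 + ‖φ x‖ ^ 2 * ‖φ' i z‖ ^ 2 / (4 * δ)
            - ‖φ' i (P x)‖ * (‖φ x‖ * ‖φ' i z‖)
            = δ * (‖φ' i (P x)‖ - ‖φ x‖ * ‖φ' i z‖ / (2 * δ)) ^ 2 := by
          field_simp
          ring
        nlinarith [mul_nonneg hδ0.le (sq_nonneg (‖φ' i (P x)‖ - ‖φ x‖ * ‖φ' i z‖ / (2 * δ)))]
      have e3 : ((starRingEnd ℂ) (φ x) * φ (f x)).re = μ.re * ‖φ x‖ ^ 2 := by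
        rw [hφf, mul_left_comm, ← Complex.normSq_eq_conj_mul_self, Complex.re_mul_ofReal,
          Complex.normSq_eq_norm_sq]
      simp only [Option.elim, LinearMap.smul_apply, LinearMap.comp_apply, smul_eq_mul]
      rw [e3, Finset.sum_congr rfl fun i _ => e1 i]
      have e4 := Finset.sum_le_sum fun i (_ : i ∈ Finset.univ) => e2 i
      rw [Finset.sum_add_distrib, ← Finset.mul_sum, ← Finset.mul_sum, Finset.sum_add_distrib,
        ← Finset.mul_sum, ← Finset.sum_div, ← Finset.mul_sum, ← hZ] at e4
      rw [← Finset.mul_sum]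
      refine (add_le_add_right e4 _).trans ?_
      set N := ∑ i, ‖φ' i (P x)‖ ^ 2 with hN
      have hN0 : 0 ≤ N := by positivity
      have k1 := mul_le_mul_of_nonneg_left key hε0.le
      have k2 : ε * (‖φ x‖ ^ 2 * Z / (4 * δ)) ≤ δ * ‖φ x‖ ^ 2 := by
        calc ε * (‖φ x‖ ^ 2 * Z / (4 * δ)) = ε * (Z / (4 * δ)) * ‖φ x‖ ^ 2 := by ring
          _ ≤ _ := by gcongr
      have k3 : μ.re * ‖φ x‖ ^ 2 ≤ ρ₀ * ‖φ x‖ ^ 2 := by gcongr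
      have k4 : 0 ≤ ‖φ x‖ ^ 2 := by positivity
      have k5 : δ = (ρ - ρ₀) / 2 := hδ
      calc _ ≤ ρ₀ * ‖φ x‖ ^ 2 + (ε * ((ρ₀ + ρ) / 2 * N) + ε * (δ * N) + δ * ‖φ x‖ ^ 2) := by
            rw [mul_add]; linarith
        _ = ρ * (‖φ x‖ ^ 2 + ε * N) - δ * ‖φ x‖ ^ 2 := by rw [k5]; ring
        _ ≤ _ := by nlinarith

/-! ### Spectral consequences of a simple dominant eigenvalue with known left eigenvector -/

section Spectral

open scoped Matrix

variable {n : Type} [Fintype n] {A : Matrix n n ℝ} {a : n → ℝ} {b : ℝ}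

/-- The real left eigenvector `a` is a left eigenvector over the complex numbers as well. -/
theorem sum_mul_map_mulVec (haA : a ᵥ* A = b • a) (x : n → ℂ) :
    ∑ i, (a i : ℂ) * (A.map (algebraMap ℝ ℂ) *ᵥ x) i = b * ∑ i, (a i : ℂ) * x i := by
  have h1 : ∀ j, ∑ i, (a i : ℂ) * (A i j : ℂ) = b * a j := by
    intro j
    have := congrFun haA j
    simp only [Matrix.vecMul, dotProduct, Pi.smul_apply, smul_eq_mul] at this
    exact_mod_cast this
  simp only [Matrix.mulVec, dotProduct, Matrix.map_apply, Complex.coe_algebraMap, Finset.mul_sum]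
  rw [Finset.sum_comm]
  refine Finset.sum_congr rfl fun j _ => ?_
  rw [← mul_assoc, ← h1 j, Finset.sum_mul]
  exact Finset.sum_congr rfl fun i _ => by ring

variable [DecidableEq n]

/-- On the kernel of the left eigenvector of the simple eigenvalue `b`, only the other eigenvalues
occur: a right eigenvector for `b` in this kernel would span the generalized eigenspace, so `a`
would vanish on it and on the complementary range of a power of `A - b`, hence everywhere. -/
theorem re_le_of_eigenvector_mem_ker {ρ₀ : ℝ} (ha : a ≠ 0) (haA : a ᵥ* A = b • a)
    (hmult : (A.map (algebraMap ℝ ℂ)).charpoly.rootMultiplicity (b : ℂ) = 1)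
    (hroots : ∀ μ ∈ (A.map (algebraMap ℝ ℂ)).charpoly.roots, μ = (b : ℂ) ∨ μ.re ≤ ρ₀)
    {w : n → ℂ} (hw : w ≠ 0) (haw : ∑ i, (a i : ℂ) * w i = 0) {μ : ℂ}
    (hAw : (A.map (algebraMap ℝ ℂ)) *ᵥ w = μ • w) : μ.re ≤ ρ₀ := by
  set B := A.map (algebraMap ℝ ℂ) with hB
  set f : Module.End ℂ (n → ℂ) := Matrix.toLin' B with hf
  have hfchar : f.charpoly = B.charpoly := Matrix.charpoly_toLin' B
  have hfw : f w = μ • w := by simpa [hf] using hAw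
  have hroot : μ ∈ B.charpoly.roots := by
    rw [Polynomial.mem_roots (Matrix.charpoly_monic B).ne_zero, ← hfchar,
      ← Module.End.hasEigenvalue_iff_isRoot_charpoly]
    exact Module.End.hasEigenvalue_of_hasEigenvector
      (x := w) ⟨Module.End.mem_eigenspace_iff.mpr hfw, hw⟩
  refine (hroots μ hroot).resolve_left fun hμ => ha ?_
  subst hμ
  let α : (n → ℂ) →ₗ[ℂ] ℂ := ∑ i, (a i : ℂ) • LinearMap.proj i
  have hα : ∀ x, α x = ∑ i, (a i : ℂ) * x i := fun x => by simp [α]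
  have hαf : ∀ x, α (f x) = b * α x := fun x => by
    rw [hα, hα, hf, Matrix.toLin'_apply, sum_mul_map_mulVec haA]
  set g := f - algebraMap ℂ (Module.End ℂ (n → ℂ)) (b : ℂ) with hg
  have hαg : ∀ x, α (g x) = 0 := by
    intro x
    simp [hg, Module.algebraMap_end_apply, hαf]
  have hfin : Module.finrank ℂ (f.maxGenEigenspace (b : ℂ)) = 1 := by
    rw [LinearMap.finrank_maxGenEigenspace_eq, hfchar, hmult]
  have hwmem : w ∈ f.maxGenEigenspace (b : ℂ) :=
    (Module.End.mem_maxGenEigenspace f _ _).mpr ⟨1, by simp [hfw]⟩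
  have hspan : ∀ x ∈ f.maxGenEigenspace (b : ℂ), α x = 0 := by
    intro x hx
    obtain ⟨c, hc⟩ := (finrank_eq_one_iff_of_nonzero' (⟨w, hwmem⟩ :
      f.maxGenEigenspace (b : ℂ)) (by simpa using hw)).mp hfin ⟨x, hx⟩
    have : c • w = x := congrArg Subtype.val hc
    rw [← this, map_smul, hα, haw, smul_zero]
  have hcompl := LinearMap.isCompl_iSup_ker_pow_iInf_range_pow g
  have hzero : ∀ x, α x = 0 := by
    intro x
    have hx : x ∈ (⨆ k : ℕ, LinearMap.ker (g ^ k)) ⊔ ⨅ k : ℕ, LinearMap.range (g ^ k) := by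
      rw [hcompl.sup_eq_top]; trivial
    obtain ⟨y, hy, z, hz, rfl⟩ := Submodule.mem_sup.mp hx
    have hy' : y ∈ f.maxGenEigenspace (b : ℂ) := by
      have hgen : ∀ k : ℕ, f.genEigenspace (b : ℂ) k = LinearMap.ker (g ^ k) := fun k => by
        rw [Module.End.genEigenspace_nat, hg, Algebra.algebraMap_eq_smul_one]
      rwa [Module.End.maxGenEigenspace, Module.End.genEigenspace_top, iSup_congr hgen]
    obtain ⟨y', hy'⟩ := (Submodule.mem_iInf _).mp hz 1
    rw [map_add, hspan y ‹_›, ← hy', pow_one, hαg, add_zero]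
  ext i
  have := hzero (Pi.single i 1)
  rw [hα] at this
  simpa [Pi.single_apply] using this

/-- The simple eigenvalue `b` has a right eigenvector that pairs to one with the left
eigenvector `a`. -/
theorem exists_dominant_eigenvector {ρ₀ : ℝ} (ha : a ≠ 0) (haA : a ᵥ* A = b • a)
    (hmult : (A.map (algebraMap ℝ ℂ)).charpoly.rootMultiplicity (b : ℂ) = 1)
    (hroots : ∀ μ ∈ (A.map (algebraMap ℝ ℂ)).charpoly.roots, μ = (b : ℂ) ∨ μ.re ≤ ρ₀)
    (hρ₀ : ρ₀ < b) : ∃ v : n → ℝ, a ⬝ᵥ v = 1 ∧ A *ᵥ v = b • v := by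
  have hdet : (A - b • (1 : Matrix n n ℝ)).det = 0 := by
    rw [← Matrix.exists_vecMul_eq_zero_iff]
    exact ⟨a, ha, by rw [Matrix.vecMul_sub, haA, Matrix.vecMul_smul, Matrix.vecMul_one, sub_self]⟩
  obtain ⟨v, hv0, hv⟩ := Matrix.exists_mulVec_eq_zero_iff.mpr hdet
  rw [Matrix.sub_mulVec, Matrix.smul_mulVec, Matrix.one_mulVec, sub_eq_zero] at hv
  have hav : a ⬝ᵥ v ≠ 0 := by
    intro h0
    have := re_le_of_eigenvector_mem_ker (w := fun i => (v i : ℂ)) (μ := (b : ℂ)) ha haA hmult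
      hroots (fun h => hv0 (funext fun i => by simpa using congrFun h i))
      (by simp only [dotProduct] at h0; exact_mod_cast h0)
      (by
        ext i
        have := congrFun hv i
        simp only [Matrix.mulVec, dotProduct, Matrix.map_apply, Complex.coe_algebraMap,
          Pi.smul_apply, smul_eq_mul] at this ⊢
        exact_mod_cast this)
    simp only [Complex.ofReal_re] at this
    linarith
  refine ⟨(a ⬝ᵥ v)⁻¹ • v, ?_, ?_⟩
  · rw [dotProduct_smul, smul_eq_mul, inv_mul_cancel₀ hav]
  · rw [Matrix.mulVec_smul, hv, smul_comm]

/-- The Lyapunov form for `A` on the hyperplane annihilated by the left eigenvector `a`. -/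
theorem exists_lyapunov_on_ker {ρ₀ ρ : ℝ} (ha : a ≠ 0) (haA : a ᵥ* A = b • a)
    (hmult : (A.map (algebraMap ℝ ℂ)).charpoly.rootMultiplicity (b : ℂ) = 1)
    (hroots : ∀ μ ∈ (A.map (algebraMap ℝ ℂ)).charpoly.roots, μ = (b : ℂ) ∨ μ.re ≤ ρ₀)
    (hρ : ρ₀ < ρ) {v : n → ℝ} (hav : a ⬝ᵥ v = 1) :
    ∃ (ι : Type) (_ : Fintype ι) (ψ : ι → (n → ℝ) →ₗ[ℝ] ℂ),
      (∀ x, a ⬝ᵥ x = 0 → (∀ i, ψ i x = 0) → x = 0) ∧ (∀ i, ψ i v = 0) ∧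
      ∀ x, a ⬝ᵥ x = 0 →
        ∑ i, ((starRingEnd ℂ) (ψ i x) * ψ i (A *ᵥ x)).re ≤ ρ * ∑ i, ‖ψ i x‖ ^ 2 := by
  set B := A.map (algebraMap ℝ ℂ) with hB
  let α : (n → ℂ) →ₗ[ℂ] ℂ := ∑ i, (a i : ℂ) • LinearMap.proj i
  have hα : ∀ x, α x = ∑ i, (a i : ℂ) * x i := fun x => by simp [α]
  have hα' : ∀ x : n → ℝ, α (fun i => (x i : ℂ)) = ((a ⬝ᵥ x : ℝ) : ℂ) := fun x => by
    rw [hα, dotProduct]; push_cast; rfl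
  have hαf : ∀ x, α (Matrix.toLin' B x) = b * α x := fun x => by
    rw [hα, hα, Matrix.toLin'_apply, sum_mul_map_mulVec haA]
  have hinv : ∀ x ∈ LinearMap.ker α, Matrix.toLin' B x ∈ LinearMap.ker α := by
    intro x hx
    rw [LinearMap.mem_ker] at hx ⊢
    rw [hαf, hx, mul_zero]
  obtain ⟨ι, _, φ, hφinj, hφ⟩ := exists_lyapunov_functionals
    ((Matrix.toLin' B).restrict hinv) hρ (by
      intro μ hμ
      obtain ⟨w, hw⟩ := hμ.exists_hasEigenvector
      refine re_le_of_eigenvector_mem_ker (w := (w : n → ℂ)) ha haA hmult hroots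
        (by simpa using hw.2) (by rw [← hα]; exact w.2) ?_
      exact congrArg Subtype.val hw.apply_eq_smul)
  let c : (n → ℝ) →ₗ[ℝ] (n → ℂ) := LinearMap.pi fun i => Complex.ofRealCLM.toLinearMap ∘ₗ
    LinearMap.proj i
  have hc : ∀ x, c x = fun i => (x i : ℂ) := fun x => rfl
  let cv : n → ℂ := fun i => (v i : ℂ)
  have hcv : α cv = 1 := by rw [hα', hav]; simp
  -- the projection onto the kernel along `v`
  let P : (n → ℂ) →ₗ[ℂ] LinearMap.ker α :=
    (LinearMap.id - α.smulRight cv).codRestrict (LinearMap.ker α) (by intro x; simp [hcv])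
  have hP : ∀ x, (P x : n → ℂ) = x - α x • cv := fun x => rfl
  have hPk : ∀ x (hx : x ∈ LinearMap.ker α), P x = ⟨x, hx⟩ := by
    intro x hx
    ext1
    rw [hP, LinearMap.mem_ker.mp hx, zero_smul, sub_zero]
  have hmem : ∀ x : n → ℝ, a ⬝ᵥ x = 0 → c x ∈ LinearMap.ker α := by
    intro x hx
    rw [LinearMap.mem_ker, hc, hα', hx, Complex.ofReal_zero]
  have hcA : ∀ x : n → ℝ, c (A *ᵥ x) = Matrix.toLin' B (c x) := by
    intro x
    ext i
    simp [hc, hB, Matrix.mulVec, dotProduct]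
  refine ⟨ι, inferInstance, fun i => (φ i ∘ₗ P).restrictScalars ℝ ∘ₗ c, ?_, ?_, ?_⟩
  · intro x hx h
    have h1 : P (c x) = 0 := hφinj _ fun i => h i
    rw [hPk _ (hmem x hx)] at h1
    have h2 := congrArg Subtype.val h1
    ext i
    have := congrFun h2 i
    simpa [hc] using this
  · intro i
    have : P (c v) = 0 := by
      ext1
      rw [hP, hc, hα', hav]
      simp [cv]
    simp [this]
  · intro x hx
    have key := hφ ⟨c x, hmem x hx⟩
    have e1 : P (c x) = ⟨c x, hmem x hx⟩ := hPk _ _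
    have e2 : P (c (A *ᵥ x)) = (Matrix.toLin' B).restrict hinv ⟨c x, hmem x hx⟩ := by
      rw [hcA, hPk _ (hinv _ (hmem x hx))]
      rfl
    simp only [LinearMap.comp_apply, LinearMap.restrictScalars_apply]
    rw [e1, e2]
    exact key

end Spectral

/-! ### The drift of the urn -/

namespace PolyaUrn

open scoped Matrix

variable {q : ℕ} (U : PolyaUrn q)

/-- The total activity as a continuous linear functional. -/
noncomputable def totalActivityL : EuclideanSpace ℝ (Fin q) →L[ℝ] ℝ :=
  ∑ i, U.activity i • EuclideanSpace.proj i

@[simp]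
theorem totalActivityL_apply (x : EuclideanSpace ℝ (Fin q)) :
    U.totalActivityL x = U.totalActivity x := by
  simp [totalActivityL, totalActivity]

/-- The mean increment of the urn from a composition `x` of positive total activity. -/
noncomputable def drift (x : EuclideanSpace ℝ (Fin q)) : EuclideanSpace ℝ (Fin q) :=
  ∑ i, (U.activity i * x i / U.totalActivity x) •
    ∫ y, y ∂(U.replacement i : Measure (EuclideanSpace ℝ (Fin q)))

variable {U} {b : ℝ}

theorem integral_replacement_apply
    (hint : ∀ i, Integrable id (U.replacement i : Measure (EuclideanSpace ℝ (Fin q))))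
    (i j : Fin q) :
    (∫ y, y ∂(U.replacement i : Measure (EuclideanSpace ℝ (Fin q)))) j
      = U.meanReplacement i j :=
  ((EuclideanSpace.proj (𝕜 := ℝ) j).integral_comp_comm (hint i)).symm

theorem drift_ofLp
    (hint : ∀ i, Integrable id (U.replacement i : Measure (EuclideanSpace ℝ (Fin q))))
    (x : EuclideanSpace ℝ (Fin q)) :
    (U.drift x).ofLp = (U.totalActivity x)⁻¹ • (U.intensityMatrix *ᵥ x.ofLp) := by
  ext j
  simp only [drift, intensityMatrix, Matrix.mulVec, dotProduct, Matrix.of_apply, Pi.smul_apply,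
    smul_eq_mul, WithLp.ofLp_sum, Finset.sum_apply, WithLp.ofLp_smul, Finset.mul_sum]
  refine Finset.sum_congr rfl fun i _ => ?_
  rw [integral_replacement_apply hint]
  ring

theorem vecMul_intensityMatrix (hb : U.IsBalancedInExpectation b) :
    U.activity ᵥ* U.intensityMatrix = b • U.activity := by
  ext j
  simp only [intensityMatrix, Matrix.vecMul, dotProduct, Matrix.of_apply, Pi.smul_apply,
    smul_eq_mul]
  rcases (U.activity_nonneg j).eq_or_lt with h | h
  · simp [← h]
  · rw [← hb.2 j h, Finset.sum_mul]
    exact Finset.sum_congr rfl fun i _ => by ring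

theorem activity_ne_zero (U : PolyaUrn q) : U.activity ≠ 0 := by
  intro h
  have := U.init_total_pos
  simp [h] at this

theorem totalActivity_drift (hb : U.IsBalancedInExpectation b)
    (hint : ∀ i, Integrable id (U.replacement i : Measure (EuclideanSpace ℝ (Fin q))))
    {x : EuclideanSpace ℝ (Fin q)} (hx : 0 < U.totalActivity x) :
    U.totalActivity (U.drift x) = b := by
  change U.activity ⬝ᵥ (U.drift x).ofLp = b
  rw [drift_ofLp hint, dotProduct_smul, Matrix.dotProduct_mulVec, vecMul_intensityMatrix hb,
    smul_dotProduct]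
  change (U.totalActivity x)⁻¹ * (b * U.totalActivity x) = b
  field_simp

theorem selectionProb_nonneg {x : EuclideanSpace ℝ (Fin q)} (hx0 : ∀ i, 0 ≤ x i)
    (hx : 0 < U.totalActivity x) (i : Fin q) :
    0 ≤ U.activity i * x i / U.totalActivity x :=
  div_nonneg (mul_nonneg (U.activity_nonneg i) (hx0 i)) hx.le

theorem selectionProb_le_one {x : EuclideanSpace ℝ (Fin q)} (hx0 : ∀ i, 0 ≤ x i)
    (hx : 0 < U.totalActivity x) (i : Fin q) :
    U.activity i * x i / U.totalActivity x ≤ 1 := by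
  rw [div_le_one hx]
  exact Finset.single_le_sum (f := fun i => U.activity i * x i)
    (fun j _ => mul_nonneg (U.activity_nonneg j) (hx0 j)) (Finset.mem_univ i)

theorem rootMultiplicity_eq_one_and_re_le {ev : Fin q → ℂ} {i₀ i₁ : Fin q} (hi₀ : (i₀ : ℕ) = 0)
    (hi₁ : (i₁ : ℕ) = 1) (hev : U.IsEigenvalueOrdering ev)
    (hev0 : ev i₀ = b) (h1 : (ev i₁).re < b) :
    (U.intensityMatrix.map (algebraMap ℝ ℂ)).charpoly.rootMultiplicity (b : ℂ) = 1 ∧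
    ∀ μ ∈ (U.intensityMatrix.map (algebraMap ℝ ℂ)).charpoly.roots,
      μ = (b : ℂ) ∨ μ.re ≤ (ev i₁).re := by
  have hre : ∀ i : Fin q, i ≠ i₀ → (ev i).re ≤ (ev i₁).re := by
    intro i hi
    apply hev.antitone_re
    have : (i : ℕ) ≠ 0 := fun h => hi (Fin.ext (h.trans hi₀.symm))
    rw [Fin.le_def, hi₁]
    omega
  constructor
  · rw [← Polynomial.count_roots, ← hev.map_eq, Multiset.count_map]
    have : (Finset.univ.filter fun i => (b : ℂ) = ev i) = {i₀} := by
      ext i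
      simp only [Finset.mem_filter, Finset.mem_univ, true_and, Finset.mem_singleton]
      constructor
      · intro h
        by_contra hi
        have := hre i hi
        rw [← h, Complex.ofReal_re] at this
        linarith
      · rintro rfl
        exact hev0.symm
    rw [← Finset.filter_val, this]
    simp
  · intro μ hμ
    rw [← hev.map_eq, Multiset.mem_map] at hμ
    obtain ⟨i, -, rfl⟩ := hμ
    by_cases hi : i = i₀
    · left; rw [hi, hev0]
    · exact Or.inr (hre i hi)

/-- In a suitable Euclidean norm `‖Λ ·‖` the drift of a strictly small urn pulls the composition
towards the line `N ↦ N b v`: at time `N` the drift, relative to the line, expands distances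
by a factor of at most `1 + κ / N` with `κ < 1 / 2`. The norm is the sum of the Lyapunov form on
the hyperplane of total activity zero and a large multiple of the square of the total activity.
Where the total activity is much smaller than `N b`, the second part dominates. -/
theorem exists_drift_form {ev : Fin q → ℂ} {i₀ i₁ : Fin q} (hi₀ : (i₀ : ℕ) = 0)
    (hi₁ : (i₁ : ℕ) = 1) (hev : U.IsEigenvalueOrdering ev)
    (hb : U.IsBalancedInExpectation b)
    (hint : ∀ i, Integrable id (U.replacement i : Measure (EuclideanSpace ℝ (Fin q))))
    (hev0 : ev i₀ = b) (hsmall : 2 * (ev i₁).re < b) :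
    ∃ (ι : Type) (_ : Fintype ι) (Λ : EuclideanSpace ℝ (Fin q) →L[ℝ] EuclideanSpace ℂ ι)
      (v : EuclideanSpace ℝ (Fin q)) (κ : ℝ),
      U.totalActivity v = 1 ∧ Function.Injective Λ ∧ 0 ≤ κ ∧ κ < 1 / 2 ∧
      ∀ x, (∀ i, 0 ≤ x i) → 0 < U.totalActivity x → ∀ N : ℝ, 0 < N →
        inner ℝ (Λ (x - (N * b) • v)) (Λ (U.drift x - b • v))
          ≤ κ / N * ‖Λ (x - (N * b) • v)‖ ^ 2 := by
  have hb0 := hb.1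
  set ρ₀ := (ev i₁).re with hρ₀
  have hρ₀b : ρ₀ < b := by
    by_contra! h
    linarith
  obtain ⟨hmult, hroots⟩ := rootMultiplicity_eq_one_and_re_le hi₀ hi₁ hev hev0 hρ₀b
  obtain ⟨v, hav, hAv⟩ := exists_dominant_eigenvector U.activity_ne_zero
    (vecMul_intensityMatrix hb) hmult hroots hρ₀b
  -- a positive `ρ` between the second eigenvalue and `b / 2`
  obtain ⟨ρ, hρ1, hρ2⟩ : ∃ ρ, max 0 ρ₀ < ρ ∧ ρ < b / 2 :=
    exists_between (max_lt (by linarith) (by linarith))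
  have hρ0 : 0 < ρ := (le_max_left _ _).trans_lt hρ1
  obtain ⟨ι, _, ψ, hinj, hψv, hψ⟩ := exists_lyapunov_on_ker U.activity_ne_zero
    (vecMul_intensityMatrix hb) hmult hroots ((le_max_right _ _).trans_lt hρ1) hav
  set β := (2 * ρ + b) / 2 with hβ
  have hβ0 : 0 < β := by rw [hβ]; linarith
  have hβb : β < b := by rw [hβ]; linarith
  set κ := ρ / β with hκ
  have hκ0 : 0 < κ := by positivity
  have hκ2 : κ < 1 / 2 := by rw [hκ, div_lt_iff₀ hβ0, hβ]; linarith
  set m : Fin q → Fin q → ℝ := fun i =>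
    (∫ y, y ∂(U.replacement i : Measure (EuclideanSpace ℝ (Fin q)))).ofLp with hm
  set D : ℝ := ∑ i, (∑ j, ‖ψ i (m j)‖) ^ 2 with hD
  have hD0 : 0 ≤ D := by positivity
  set K := √(D / (4 * κ ^ 2 * (b - β) ^ 2) + 1) with hK
  have hbβ : 0 < b - β := by linarith
  have hK0 : 0 < K := Real.sqrt_pos.mpr (by positivity)
  have hK2 : D ≤ K ^ 2 * (4 * κ ^ 2 * (b - β) ^ 2) := by
    rw [hK, Real.sq_sqrt (by positivity), add_mul, div_mul_cancel₀ _ (by positivity)]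
    linarith [show 0 ≤ 1 * (4 * κ ^ 2 * (b - β) ^ 2) by positivity]
  let Λ₀ : EuclideanSpace ℝ (Fin q) →ₗ[ℝ] EuclideanSpace ℂ (Option ι) :=
    (WithLp.linearEquiv 2 ℝ (Option ι → ℂ)).symm.toLinearMap ∘ₗ
      LinearMap.pi fun o => o.elim
        (Complex.ofRealCLM.toLinearMap ∘ₗ (K • U.totalActivityL.toLinearMap))
        fun i => ψ i ∘ₗ (WithLp.linearEquiv 2 ℝ (Fin q → ℝ)).toLinearMap
  let Λ : EuclideanSpace ℝ (Fin q) →L[ℝ] EuclideanSpace ℂ (Option ι) :=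
    LinearMap.toContinuousLinearMap Λ₀
  have hΛn : ∀ x, Λ x none = ((K * U.totalActivity x : ℝ) : ℂ) := fun x => by
    simp [Λ, Λ₀]
  have hΛs : ∀ x i, Λ x (some i) = ψ i x.ofLp := fun x i => rfl
  have hSv : U.totalActivity (WithLp.toLp 2 v) = 1 := hav
  refine ⟨Option ι, inferInstance, Λ, WithLp.toLp 2 v, κ, hSv, ?_, hκ0.le, hκ2, ?_⟩
  · rw [injective_iff_map_eq_zero]
    intro x hx
    have h0 : U.totalActivity x = 0 := by
      have := hΛn x
      rw [hx, PiLp.zero_apply] at this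
      have h2 : K * U.totalActivity x = 0 := Complex.ofReal_eq_zero.mp this.symm
      exact (mul_eq_zero.mp h2).resolve_left hK0.ne'
    have h1 := hinj x.ofLp h0 fun i => by rw [← hΛs, hx]; rfl
    ext i
    exact congrFun h1 i
  · intro x hx0 hSx N hN
    set S := U.totalActivity x with hS
    set w : Fin q → ℝ := x.ofLp - S • v with hw
    have haw : U.activity ⬝ᵥ w = 0 := by
      rw [hw, dotProduct_sub, dotProduct_smul, hav]
      change S - S * 1 = 0
      ring
    set Ψ := ∑ i, ‖ψ i w‖ ^ 2 with hΨ
    have hΨ0 : 0 ≤ Ψ := by positivity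
    have hz : ∀ i, Λ (x - (N * b) • WithLp.toLp 2 v) (some i) = ψ i w := by
      intro i
      rw [hΛs, WithLp.ofLp_sub, WithLp.ofLp_smul, hw, map_sub, map_sub, map_smul, map_smul, hψv]
      simp
    have hz0 : Λ (x - (N * b) • WithLp.toLp 2 v) none = ((K * (S - N * b) : ℝ) : ℂ) := by
      rw [hΛn, ← totalActivityL_apply, map_sub, map_smul, totalActivityL_apply,
        totalActivityL_apply, hSv, smul_eq_mul, mul_one]
    have hd0 : Λ (U.drift x - b • WithLp.toLp 2 v) none = 0 := by
      rw [hΛn, ← totalActivityL_apply, map_sub, map_smul, totalActivityL_apply,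
        totalActivityL_apply, hSv, totalActivity_drift hb hint hSx, smul_eq_mul, mul_one, sub_self,
        mul_zero, Complex.ofReal_zero]
    have hd : ∀ i, Λ (U.drift x - b • WithLp.toLp 2 v) (some i) = ψ i (U.drift x).ofLp := by
      intro i
      rw [hΛs, WithLp.ofLp_sub, WithLp.ofLp_smul, map_sub, map_smul, hψv, smul_zero, sub_zero]
    have hdw : ∀ i, ψ i (U.drift x).ofLp = (S⁻¹ : ℝ) • ψ i (U.intensityMatrix *ᵥ w) := by
      intro i
      rw [drift_ofLp hint, map_smul, hw, Matrix.mulVec_sub, Matrix.mulVec_smul, hAv, map_sub,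
        map_smul, map_smul, hψv, smul_zero, smul_zero, sub_zero, hS]
    have hnorm : ‖Λ (x - (N * b) • WithLp.toLp 2 v)‖ ^ 2 = K ^ 2 * (S - N * b) ^ 2 + Ψ := by
      rw [EuclideanSpace.norm_sq_eq, Fintype.sum_option, hz0, Complex.norm_real, Real.norm_eq_abs,
        sq_abs, mul_pow]
      simp only [hz, hΨ]
    have hinner : inner ℝ (Λ (x - (N * b) • WithLp.toLp 2 v)) (Λ (U.drift x - b • WithLp.toLp 2 v))
        = ∑ i, ((starRingEnd ℂ) (ψ i w) * ψ i (U.drift x).ofLp).re := by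
      rw [PiLp.inner_apply, Fintype.sum_option, hd0, inner_zero_right, zero_add]
      simp only [hz, hd, Complex.inner]
      exact Finset.sum_congr rfl fun i _ => by rw [mul_comm]
    rw [hnorm, hinner]
    rcases le_or_gt (β * N) S with hSN | hSN
    · have h1 : ∑ i, ((starRingEnd ℂ) (ψ i w) * ψ i (U.drift x).ofLp).re
          = S⁻¹ * ∑ i, ((starRingEnd ℂ) (ψ i w) * ψ i (U.intensityMatrix *ᵥ w)).re := by
        rw [Finset.mul_sum]
        refine Finset.sum_congr rfl fun i _ => ?_
        rw [hdw, Complex.real_smul, mul_left_comm, Complex.re_ofReal_mul]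
      rw [h1]
      calc _ ≤ S⁻¹ * (ρ * Ψ) := by
            have := hψ w haw
            gcongr
        _ ≤ (β * N)⁻¹ * (ρ * Ψ) := by gcongr
        _ = κ / N * Ψ := by rw [hκ]; field_simp
        _ ≤ _ := by
            gcongr
            nlinarith [sq_nonneg (K * (S - N * b))]
    · have hψd : ∑ i, ‖ψ i (U.drift x).ofLp‖ ^ 2 ≤ D := by
        refine Finset.sum_le_sum fun i _ => ?_
        gcongr
        have : (U.drift x).ofLp = ∑ j, (U.activity j * x j / S) • m j := by
          simp [drift, hm, hS, WithLp.ofLp_sum]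
        rw [this, map_sum]
        refine (norm_sum_le _ _).trans (Finset.sum_le_sum fun j _ => ?_)
        rw [map_smul, norm_smul, Real.norm_of_nonneg (selectionProb_nonneg hx0 hSx j)]
        exact mul_le_of_le_one_left (norm_nonneg _) (selectionProb_le_one hx0 hSx j)
      have h1 : ∑ i, ((starRingEnd ℂ) (ψ i w) * ψ i (U.drift x).ofLp).re
          ≤ ∑ i, (κ / N * ‖ψ i w‖ ^ 2 + N / (4 * κ) * ‖ψ i (U.drift x).ofLp‖ ^ 2) := by
        refine Finset.sum_le_sum fun i _ => (Complex.re_le_norm _).trans ?_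
        rw [norm_mul, RCLike.norm_conj]
        have : κ / N * ‖ψ i w‖ ^ 2 + N / (4 * κ) * ‖ψ i (U.drift x).ofLp‖ ^ 2
            - ‖ψ i w‖ * ‖ψ i (U.drift x).ofLp‖
            = κ / N * (‖ψ i w‖ - N / (2 * κ) * ‖ψ i (U.drift x).ofLp‖) ^ 2 := by
          field_simp
          ring
        linarith [show 0 ≤ κ / N * (‖ψ i w‖ - N / (2 * κ) * ‖ψ i (U.drift x).ofLp‖) ^ 2 by
          positivity]
      rw [Finset.sum_add_distrib, ← Finset.mul_sum, ← Finset.mul_sum, ← hΨ] at h1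
      have h2 : N / (4 * κ) * ∑ i, ‖ψ i (U.drift x).ofLp‖ ^ 2
          ≤ κ / N * (K ^ 2 * (S - N * b) ^ 2) := by
        have h3 : ((b - β) * N) ^ 2 ≤ (S - N * b) ^ 2 := by
          rw [← neg_sq (S - N * b)]
          have : (b - β) * N ≤ -(S - N * b) := by linarith
          gcongr
        calc _ ≤ N / (4 * κ) * (K ^ 2 * (4 * κ ^ 2 * (b - β) ^ 2)) := by
              gcongr
              exact hψd.trans hK2
          _ = κ / N * (K ^ 2 * ((b - β) * N) ^ 2) := by field_simp
          _ ≤ _ := by gcongr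
      calc _ ≤ _ := h1
        _ ≤ κ / N * Ψ + κ / N * (K ^ 2 * (S - N * b) ^ 2) := by gcongr
        _ = _ := by ring

end PolyaUrn

/-! ### The transition kernel of the urn -/

namespace PolyaUrn

variable {q : ℕ} (U : PolyaUrn q)

/-- The compositions from which the urn makes a proper step: non-negative and of positive total
activity. -/
def activeCompositions : Set (EuclideanSpace ℝ (Fin q)) :=
  {x | (∀ i, 0 ≤ x i) ∧ 0 < U.totalActivity x}

@[fun_prop]
theorem continuous_totalActivity : Continuous U.totalActivity := by
  unfold totalActivity
  fun_prop

theorem measurableSet_activeCompositions : MeasurableSet U.activeCompositions := by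
  have h1 : MeasurableSet {x : EuclideanSpace ℝ (Fin q) | ∀ i, 0 ≤ x i} := by
    rw [Set.ofPred_forall]
    exact MeasurableSet.iInter fun i => measurableSet_le measurable_const (by fun_prop)
  exact h1.inter (measurableSet_lt measurable_const U.continuous_totalActivity.measurable)

/-- The law of the increment of the urn from the composition `x`; outside the active compositions
the increment is zero. -/
noncomputable def stepKernel :
    Kernel (EuclideanSpace ℝ (Fin q)) (EuclideanSpace ℝ (Fin q)) where
  toFun x := open scoped Classical in
    if x ∈ U.activeCompositions then
      ∑ i, ENNReal.ofReal (U.activity i * x i / U.totalActivity x) •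
        (U.replacement i : Measure (EuclideanSpace ℝ (Fin q)))
    else Measure.dirac 0
  measurable' := by
    classical
    refine Measurable.ite U.measurableSet_activeCompositions ?_ measurable_const
    refine Measure.measurable_of_measurable_coe _ fun B _ => ?_
    simp only [Measure.coe_finsetSum, Finset.sum_apply, Measure.smul_apply, smul_eq_mul]
    have := U.continuous_totalActivity.measurable
    fun_prop

variable {U}

theorem stepKernel_apply {x : EuclideanSpace ℝ (Fin q)} (hx : x ∈ U.activeCompositions) :
    U.stepKernel x = ∑ i, ENNReal.ofReal (U.activity i * x i / U.totalActivity x) •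
      (U.replacement i : Measure (EuclideanSpace ℝ (Fin q))) :=
  if_pos hx

theorem stepKernel_apply_of_notMem {x : EuclideanSpace ℝ (Fin q)}
    (hx : x ∉ U.activeCompositions) : U.stepKernel x = Measure.dirac 0 :=
  if_neg hx

theorem sum_selectionProb {x : EuclideanSpace ℝ (Fin q)} (hx : 0 < U.totalActivity x) :
    ∑ i, U.activity i * x i / U.totalActivity x = 1 := by
  rw [← Finset.sum_div]
  exact div_self hx.ne'

instance : IsMarkovKernel U.stepKernel where
  isProbabilityMeasure x := by
    by_cases hx : x ∈ U.activeCompositions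
    · constructor
      rw [stepKernel_apply hx]
      simp only [Measure.coe_finsetSum, Finset.sum_apply, Measure.smul_apply, smul_eq_mul,
        measure_univ, mul_one]
      rw [← ENNReal.ofReal_sum_of_nonneg fun i _ => selectionProb_nonneg hx.1 hx.2 i,
        sum_selectionProb hx.2, ENNReal.ofReal_one]
    · rw [stepKernel_apply_of_notMem hx]
      infer_instance

theorem stepKernel_real {x : EuclideanSpace ℝ (Fin q)} (hx : ∀ i, 0 ≤ x i)
    {B : Set (EuclideanSpace ℝ (Fin q))} (hB : MeasurableSet B) :
    (U.stepKernel x).real B = U.incrementProb x B := by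
  classical
  unfold incrementProb
  by_cases h : 0 < U.totalActivity x
  · rw [if_pos h, stepKernel_apply ⟨hx, h⟩, measureReal_def]
    simp only [Measure.coe_finsetSum, Finset.sum_apply, Measure.smul_apply, smul_eq_mul]
    rw [ENNReal.toReal_sum fun i _ => ENNReal.mul_ne_top ENNReal.ofReal_ne_top (measure_ne_top _ _)]
    refine Finset.sum_congr rfl fun i _ => ?_
    rw [ENNReal.toReal_mul, ENNReal.toReal_ofReal (selectionProb_nonneg hx h i), measureReal_def]
  · rw [if_neg h, stepKernel_apply_of_notMem fun h' => h h'.2, measureReal_def,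
      Measure.dirac_apply' _ hB]
    by_cases h0 : (0 : EuclideanSpace ℝ (Fin q)) ∈ B <;> simp [h0]

theorem integrable_stepKernel {F : Type*} [NormedAddCommGroup F]
    {g : EuclideanSpace ℝ (Fin q) → F}
    (hg : ∀ i, Integrable g (U.replacement i : Measure (EuclideanSpace ℝ (Fin q))))
    (x : EuclideanSpace ℝ (Fin q)) : Integrable g (U.stepKernel x) := by
  by_cases hx : x ∈ U.activeCompositions
  · rw [stepKernel_apply hx, integrable_finsetSum_measure]
    exact fun i _ => (hg i).smul_measure ENNReal.ofReal_ne_top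
  · rw [stepKernel_apply_of_notMem hx]
    exact integrable_dirac (by simp)

theorem integral_stepKernel {F : Type*} [NormedAddCommGroup F] [NormedSpace ℝ F]
    {g : EuclideanSpace ℝ (Fin q) → F}
    (hg : ∀ i, Integrable g (U.replacement i : Measure (EuclideanSpace ℝ (Fin q))))
    {x : EuclideanSpace ℝ (Fin q)} (hx : x ∈ U.activeCompositions) :
    ∫ y, g y ∂U.stepKernel x = ∑ i, (U.activity i * x i / U.totalActivity x) •
      ∫ y, g y ∂(U.replacement i : Measure (EuclideanSpace ℝ (Fin q))) := by
  rw [stepKernel_apply hx, integral_finsetSum_measure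
    fun i _ => (hg i).smul_measure ENNReal.ofReal_ne_top]
  refine Finset.sum_congr rfl fun i _ => ?_
  rw [integral_smul_measure, ENNReal.toReal_ofReal (selectionProb_nonneg hx.1 hx.2 i)]

theorem integral_stepKernel_le {g : EuclideanSpace ℝ (Fin q) → ℝ} (hg0 : ∀ y, 0 ≤ g y)
    (hg : ∀ i, Integrable g (U.replacement i : Measure (EuclideanSpace ℝ (Fin q))))
    {x : EuclideanSpace ℝ (Fin q)} (hx : x ∈ U.activeCompositions) :
    ∫ y, g y ∂U.stepKernel x
      ≤ ∑ i, ∫ y, g y ∂(U.replacement i : Measure (EuclideanSpace ℝ (Fin q))) := by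
  rw [integral_stepKernel hg hx]
  refine Finset.sum_le_sum fun i _ => ?_
  exact mul_le_of_le_one_left (integral_nonneg hg0) (selectionProb_le_one hx.1 hx.2 i)

variable {Ω : Type*} [MeasurableSpace Ω] {μ : Measure Ω} [IsProbabilityMeasure μ]
  {X : ℕ → Ω → EuclideanSpace ℝ (Fin q)}

/-- The composition and the next increment have the joint law prescribed by the kernel. -/
theorem map_increment_eq_compProd (hX : U.IsUrnEvolution μ X) (ht : IsTenable μ X) (n : ℕ) :
    μ.map (fun ω => (X n ω, X (n + 1) ω - X n ω)) = (μ.map (X n)) ⊗ₘ U.stepKernel := by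
  have hm := hX.measurable
  have hpair : Measurable fun ω => (X n ω, X (n + 1) ω - X n ω) :=
    (hm n).prodMk ((hm (n + 1)).sub (hm n))
  have : IsProbabilityMeasure (μ.map fun ω => (X n ω, X (n + 1) ω - X n ω)) :=
    Measure.isProbabilityMeasure_map hpair.aemeasurable
  have : IsProbabilityMeasure (μ.map (X n)) :=
    Measure.isProbabilityMeasure_map (hm n).aemeasurable
  refine Measure.ext_prod fun {A B} hA hB => ?_
  set ℱ := Filtration.natural X (fun k => (hm k).stronglyMeasurable) with hℱ
  have hAℱ : MeasurableSet[ℱ n] (X n ⁻¹' A) := by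
    exact (le_iSup₂ (f := fun j (_ : j ≤ n) => MeasurableSpace.comap (X j) _) n le_rfl :
      MeasurableSpace.comap (X n) _ ≤ ℱ n) _ ⟨A, hA, rfl⟩
  have hBm : MeasurableSet {ω | X (n + 1) ω - X n ω ∈ B} := ((hm (n + 1)).sub (hm n)) hB
  have hAm : MeasurableSet (X n ⁻¹' A) := hm n hA
  have h1 : ∫ ω in X n ⁻¹' A, U.incrementProb (X n ω) B ∂μ
      = μ.real ({ω | X (n + 1) ω - X n ω ∈ B} ∩ X n ⁻¹' A) := by
    rw [← setIntegral_congr_ae hAm ((hX.condLaw n B hB).mono fun ω h _ => h),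
      setIntegral_condExp (ℱ.le n) ((integrable_const _).indicator hBm) hAℱ,
      integral_indicator_const _ hBm, measureReal_restrict_apply hBm, smul_eq_mul, mul_one]
  have h2 : ∫ ω in X n ⁻¹' A, U.incrementProb (X n ω) B ∂μ
      = ∫ ω in X n ⁻¹' A, (U.stepKernel (X n ω) B).toReal ∂μ :=
    setIntegral_congr_ae hAm ((ht n).mono fun ω h _ => (stepKernel_real h hB).symm)
  have hmeas : Measurable fun ω => U.stepKernel (X n ω) B :=
    (U.stepKernel.measurable_coe hB).comp (hm n)
  rw [integral_toReal hmeas.aemeasurable (by simp [measure_lt_top])] at h2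
  rw [Measure.compProd_apply_prod hA hB, setLIntegral_map hA (U.stepKernel.measurable_coe hB)
    (hm n), Measure.map_apply hpair (hA.prod hB)]
  have h3 : (fun ω => (X n ω, X (n + 1) ω - X n ω)) ⁻¹' (A ×ˢ B)
      = {ω | X (n + 1) ω - X n ω ∈ B} ∩ X n ⁻¹' A := by
    ext ω; simp [and_comm]
  rw [h3, ← ENNReal.toReal_eq_toReal_iff' (measure_ne_top _ _)]
  · rw [← h2, h1, measureReal_def]
  · refine ne_top_of_le_ne_top (measure_ne_top μ (X n ⁻¹' A)) ?_
    calc ∫⁻ ω in X n ⁻¹' A, U.stepKernel (X n ω) B ∂μ ≤ ∫⁻ ω in X n ⁻¹' A, 1 ∂μ :=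
          lintegral_mono fun ω => prob_le_one
      _ = _ := by simp

theorem integral_increment (hX : U.IsUrnEvolution μ X) (ht : IsTenable μ X) (n : ℕ)
    {g : EuclideanSpace ℝ (Fin q) × EuclideanSpace ℝ (Fin q) → ℝ} (hg : Measurable g)
    (hint : Integrable (fun ω => g (X n ω, X (n + 1) ω - X n ω)) μ) :
    ∫ ω, g (X n ω, X (n + 1) ω - X n ω) ∂μ
      = ∫ ω, ∫ y, g (X n ω, y) ∂U.stepKernel (X n ω) ∂μ := by
  have hm := hX.measurable
  have hpair : Measurable fun ω => (X n ω, X (n + 1) ω - X n ω) :=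
    (hm n).prodMk ((hm (n + 1)).sub (hm n))
  have : IsProbabilityMeasure (μ.map (X n)) :=
    Measure.isProbabilityMeasure_map (hm n).aemeasurable
  have hint' : Integrable g (μ.map fun ω => (X n ω, X (n + 1) ω - X n ω)) :=
    (integrable_map_measure hg.aestronglyMeasurable hpair.aemeasurable).mpr hint
  rw [← integral_map hpair.aemeasurable hg.aestronglyMeasurable,
    map_increment_eq_compProd hX ht n, Measure.integral_compProd
      (by rwa [← map_increment_eq_compProd hX ht n]), integral_map (hm n).aemeasurable]
  exact (hg.stronglyMeasurable.integral_kernel_prod_right').aestronglyMeasurable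

theorem integrable_increment_pow (hX : U.IsUrnEvolution μ X) (ht : IsTenable μ X)
    {k : ℕ} (hk : k ≠ 0)
    (hmom : ∀ i, Integrable (fun y => ‖y‖ ^ k)
      (U.replacement i : Measure (EuclideanSpace ℝ (Fin q)))) (n : ℕ) :
    Integrable (fun ω => ‖X (n + 1) ω - X n ω‖ ^ k) μ := by
  have hm := hX.measurable
  have hpair : Measurable fun ω => (X n ω, X (n + 1) ω - X n ω) :=
    (hm n).prodMk ((hm (n + 1)).sub (hm n))
  have : IsProbabilityMeasure (μ.map (X n)) :=
    Measure.isProbabilityMeasure_map (hm n).aemeasurable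
  have hg : Measurable fun p : EuclideanSpace ℝ (Fin q) × EuclideanSpace ℝ (Fin q) =>
    ‖p.2‖ ^ k := by fun_prop
  change Integrable ((fun p : EuclideanSpace ℝ (Fin q) × EuclideanSpace ℝ (Fin q) =>
    ‖p.2‖ ^ k) ∘ fun ω => (X n ω, X (n + 1) ω - X n ω)) μ
  rw [← integrable_map_measure hg.aestronglyMeasurable hpair.aemeasurable,
    map_increment_eq_compProd hX ht n, Measure.integrable_compProd_iff hg.aestronglyMeasurable]
  refine ⟨Eventually.of_forall fun x => integrable_stepKernel hmom x, ?_⟩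
  refine Integrable.of_bound
    (C := ∑ i, ∫ y, ‖y‖ ^ k ∂(U.replacement i : Measure (EuclideanSpace ℝ (Fin q))))
    (hg.norm.stronglyMeasurable.integral_kernel_prod_right').aestronglyMeasurable
    (Eventually.of_forall fun x => ?_)
  simp only [norm_pow, norm_norm]
  rw [Real.norm_of_nonneg (integral_nonneg fun y => by positivity)]
  by_cases hx : x ∈ U.activeCompositions
  · exact integral_stepKernel_le (fun y => by positivity) hmom hx
  · rw [stepKernel_apply_of_notMem hx, integral_dirac, norm_zero, zero_pow hk]
    exact Finset.sum_nonneg fun i _ => integral_nonneg fun y => by positivity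

/-- All absolute moments of the compositions are finite. -/
theorem integrable_composition_pow (hX : U.IsUrnEvolution μ X) (ht : IsTenable μ X)
    (hmom : ∀ i (k : ℕ), Integrable (fun y => ‖y‖ ^ k)
      (U.replacement i : Measure (EuclideanSpace ℝ (Fin q)))) (n k : ℕ) :
    Integrable (fun ω => ‖X n ω‖ ^ k) μ := by
  rcases Nat.eq_zero_or_pos k with rfl | hk
  · simp
  induction n with
  | zero =>
    refine (integrable_const (‖U.init‖ ^ k)).congr ?_
    filter_upwards [hX.init_eq] with ω hω
    rw [hω]
  | succ n ih =>
    have h := (ih.add (integrable_increment_pow hX ht hk.ne' (fun i => hmom i k) n)).const_mul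
      ((2 : ℝ) ^ (k - 1))
    refine h.mono' ((hX.measurable (n + 1)).norm.pow_const k).aestronglyMeasurable
      (Eventually.of_forall fun ω => ?_)
    rw [Real.norm_of_nonneg (by positivity)]
    calc ‖X (n + 1) ω‖ ^ k ≤ (‖X n ω‖ + ‖X (n + 1) ω - X n ω‖) ^ k := by
          gcongr
          calc ‖X (n + 1) ω‖ = ‖X n ω + (X (n + 1) ω - X n ω)‖ := by rw [add_sub_cancel]
            _ ≤ _ := norm_add_le _ _
      _ ≤ _ := add_pow_le (norm_nonneg _) (norm_nonneg _) k

end PolyaUrn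

/-- A continuous function of polynomial growth is integrable if all moments are finite. -/
theorem integrable_comp_of_norm_le_pow {E F Ω : Type*} [NormedAddCommGroup E] [MeasurableSpace E]
    [BorelSpace E] [SecondCountableTopology E] [NormedAddCommGroup F] [MeasurableSpace Ω]
    {μ : Measure Ω} [IsFiniteMeasure μ] {Z : Ω → E} (hZ : Measurable Z)
    (hmom : ∀ k : ℕ, Integrable (fun ω => ‖Z ω‖ ^ k) μ) {g : E → F} (hg : Continuous g)
    (C : ℝ) (k : ℕ) (hgC : ∀ x, ‖g x‖ ≤ C * (1 + ‖x‖) ^ k) :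
    Integrable (fun ω => g (Z ω)) μ := by
  have hC : 0 ≤ C := by simpa using (norm_nonneg _).trans (hgC 0)
  have h := ((integrable_const (1 : ℝ)).add (hmom k)).const_mul (C * 2 ^ (k - 1))
  refine h.mono' (hg.comp_aestronglyMeasurable hZ.aestronglyMeasurable)
    (Eventually.of_forall fun ω => (hgC _).trans ?_)
  simp only [Pi.add_apply]
  rw [mul_assoc]
  gcongr
  simpa using add_pow_le zero_le_one (norm_nonneg (Z ω)) k

/-! ### Growth of moments -/

/-- A first order Taylor bound for an even power of the norm, in terms of the scalars
`r = ‖V‖²`, `x = ⟪V, D⟫`, `e = ‖D‖²`. -/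
theorem exists_pow_add_le (m : ℕ) : ∃ C : ℝ, 0 ≤ C ∧ ∀ r e x : ℝ, 0 ≤ r → 0 ≤ e →
    x ^ 2 ≤ r * e → 2 * x ≤ r + e → 0 ≤ r + 2 * x + e →
    (r + 2 * x + e) ^ (m + 1)
      ≤ r ^ (m + 1) + 2 * (m + 1) * r ^ m * x + C * (r ^ m * e + e ^ (m + 1)) := by
  induction m with
  | zero =>
    refine ⟨1, zero_le_one, fun r e x hr he _ _ _ => ?_⟩
    norm_num
    linarith
  | succ m ih =>
    obtain ⟨C, hC, h⟩ := ih
    refine ⟨6 * (m + 1) + 1 + 6 * C, by positivity, fun r e x hr he hx h2 h3 => ?_⟩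
    have hT : r + 2 * x + e ≤ 2 * (r + e) := by linarith
    have key := mul_le_mul_of_nonneg_right (h r e x hr he hx h2 h3) h3
    rw [← pow_succ] at key
    refine key.trans ?_
    have hrm : 0 ≤ r ^ m := by positivity
    have hM : (0 : ℝ) ≤ m + 1 := by positivity
    -- the mixed products `r ^ m * e ^ 2` and `r * e ^ (m + 1)` are dominated by the extreme ones
    have b1 : r ^ m * e ^ 2 ≤ r ^ (m + 1) * e + e ^ (m + 2) := by
      rcases le_total r e with hre | hre
      · have h0 : 0 ≤ r ^ (m + 1) * e := by positivity
        calc r ^ m * e ^ 2 ≤ e ^ m * e ^ 2 := by gcongr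
          _ = e ^ (m + 2) := by ring
          _ ≤ _ := by linarith
      · have : r ^ m * e * e ≤ r ^ m * e * r := by gcongr
        have h0 : 0 ≤ e ^ (m + 2) := by positivity
        calc r ^ m * e ^ 2 = r ^ m * e * e := by ring
          _ ≤ r ^ m * e * r := this
          _ = r ^ (m + 1) * e := by ring
          _ ≤ _ := by linarith
    have b2 : r * e ^ (m + 1) ≤ r ^ (m + 1) * e + e ^ (m + 2) := by
      rcases le_total r e with hre | hre
      · have : r * e ^ (m + 1) ≤ e * e ^ (m + 1) := by gcongr
        have h0 : 0 ≤ r ^ (m + 1) * e := by positivity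
        calc _ ≤ e * e ^ (m + 1) := this
          _ = e ^ (m + 2) := by ring
          _ ≤ _ := by linarith
      · have : e ^ m * (r * e) ≤ r ^ m * (r * e) := by gcongr
        have h0 : 0 ≤ e ^ (m + 2) := by positivity
        calc r * e ^ (m + 1) = e ^ m * (r * e) := by ring
          _ ≤ r ^ m * (r * e) := this
          _ = r ^ (m + 1) * e := by ring
          _ ≤ _ := by linarith
    have b3 : r ^ m * x ^ 2 ≤ r ^ (m + 1) * e := by
      calc r ^ m * x ^ 2 ≤ r ^ m * (r * e) := by gcongr
        _ = _ := by ring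
    have b4 : r ^ m * (2 * x) * e ≤ r ^ (m + 1) * e + r ^ m * e ^ 2 := by
      calc r ^ m * (2 * x) * e ≤ r ^ m * (r + e) * e := by gcongr
        _ = _ := by ring
    have b5 : C * (r ^ m * e + e ^ (m + 1)) * (r + 2 * x + e)
        ≤ 2 * C * (r ^ (m + 1) * e + r ^ m * e ^ 2 + r * e ^ (m + 1) + e ^ (m + 2)) := by
      calc _ ≤ C * (r ^ m * e + e ^ (m + 1)) * (2 * (r + e)) := by gcongr
        _ = _ := by ring
    have b6 := mul_le_mul_of_nonneg_left b3 hM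
    have b7 := mul_le_mul_of_nonneg_left b4 hM
    have b8 := mul_le_mul_of_nonneg_left b1 hM
    have b9 := mul_le_mul_of_nonneg_left b1 hC
    have b10 := mul_le_mul_of_nonneg_left b2 hC
    have p1 : 0 ≤ r ^ (m + 1) * e := by positivity
    have p2 : 0 ≤ e ^ (m + 2) := by positivity
    have p3 := mul_nonneg hM p1
    have p4 := mul_nonneg hM p2
    push_cast
    have expand : (r ^ (m + 1) + 2 * (m + 1) * r ^ m * x + C * (r ^ m * e + e ^ (m + 1))) *
        (r + 2 * x + e)
        = r ^ (m + 2) + 2 * (m + 1 + 1) * r ^ (m + 1) * x + r ^ (m + 1) * e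
          + 4 * ((m + 1) * (r ^ m * x ^ 2)) + (m + 1) * (r ^ m * (2 * x) * e)
          + C * (r ^ m * e + e ^ (m + 1)) * (r + 2 * x + e) := by ring
    rw [expand]
    have e2 : e ^ (m + 1 + 1) = e ^ (m + 2) := rfl
    have e3 : r ^ (m + 1 + 1) = r ^ (m + 2) := rfl
    rw [e2, e3]
    nlinarith

theorem exists_norm_add_pow_le (m : ℕ) : ∃ C : ℝ, 0 ≤ C ∧ ∀ {H : Type} [NormedAddCommGroup H]
    [InnerProductSpace ℝ H] (V D : H),
    ‖V + D‖ ^ (2 * (m + 1)) ≤ ‖V‖ ^ (2 * (m + 1)) + 2 * (m + 1) * ‖V‖ ^ (2 * m) * inner ℝ V D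
      + C * (‖V‖ ^ (2 * m) * ‖D‖ ^ 2 + ‖D‖ ^ (2 * (m + 1))) := by
  obtain ⟨C, hC, h⟩ := exists_pow_add_le m
  refine ⟨C, hC, fun V D => ?_⟩
  have hx := abs_real_inner_le_norm V D
  have h1 : (inner ℝ V D) ^ 2 ≤ ‖V‖ ^ 2 * ‖D‖ ^ 2 := by
    rw [← mul_pow, ← sq_abs (inner ℝ V D)]
    gcongr
  have h2 : 2 * inner ℝ V D ≤ ‖V‖ ^ 2 + ‖D‖ ^ 2 := by
    nlinarith [sq_nonneg (‖V‖ - ‖D‖), le_abs_self (inner ℝ V D)]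
  have := h (‖V‖ ^ 2) (‖D‖ ^ 2) (inner ℝ V D) (by positivity) (by positivity) h1 h2
    (by rw [← norm_add_sq_real]; positivity)
  rw [← norm_add_sq_real] at this
  simpa only [← pow_mul] using this

/-- A sequence growing by at most a factor `1 + (m + 1) θ / (n + 1)` with `θ < 1`, up to an error of
order `n ^ m`, is of order `n ^ (m + 1)`. The second sequence `w` sits between consecutive
terms of the first. -/
theorem exists_growth_bound {u w : ℕ → ℝ} {θ C : ℝ} (m : ℕ) (hθ0 : 0 ≤ θ) (hθ : θ < 1)
    (hw : ∀ n : ℕ, w n ≤ (1 + (m + 1) * θ / (n + 1)) * u n + C * (n + 1) ^ m)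
    (hu : ∀ n, u (n + 1) ≤ w n) :
    ∃ K : ℝ, 0 ≤ K ∧ ∀ n : ℕ, u n ≤ K * (n + 1) ^ (m + 1) ∧ w n ≤ K * (n + 2) ^ (m + 1) := by
  set K := max (max 0 (u 0)) (C / (1 - θ)) with hK
  have hK0 : 0 ≤ K := (le_max_left _ _).trans (le_max_left _ _)
  have hKC : C ≤ K * (1 - θ) := by
    rw [← div_le_iff₀ (by linarith)]
    exact le_max_right _ _
  have step : ∀ n : ℕ, u n ≤ K * (n + 1) ^ (m + 1) → w n ≤ K * (n + 2) ^ (m + 1) := by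
    intro n hn
    set N : ℝ := n + 1 with hN
    have hN0 : 0 < N := by positivity
    have hpow : N ^ (m + 1) + (m + 1) * N ^ m ≤ (N + 1) ^ (m + 1) := by
      have h1 := one_add_mul_le_pow (a := 1 / N)
        (by have : 0 ≤ 1 / N := by positivity
            linarith) (m + 1)
      have h2 := mul_le_mul_of_nonneg_left h1 (pow_nonneg hN0.le (m + 1))
      rw [← mul_pow] at h2
      have h3 : N * (1 + 1 / N) = N + 1 := by field_simp
      rw [h3] at h2
      refine le_trans (le_of_eq ?_) h2
      push_cast
      field_simp
      ring
    have hm0 : 0 ≤ N ^ m := by positivity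
    calc w n ≤ (1 + (m + 1) * θ / N) * u n + C * N ^ m := hw n
      _ ≤ (1 + (m + 1) * θ / N) * (K * N ^ (m + 1)) + K * (1 - θ) * N ^ m := by gcongr
      _ = K * N ^ (m + 1) + K * (m + 1) * θ * N ^ m + K * (1 - θ) * N ^ m := by
          field_simp
          ring
      _ ≤ K * (N ^ (m + 1) + (m + 1) * N ^ m) := by
          have : 0 ≤ K * (m * (1 - θ)) * N ^ m := by
            have : 0 ≤ 1 - θ := by linarith
            positivity
          nlinarith
      _ ≤ K * (N + 1) ^ (m + 1) := by gcongr
      _ = K * (n + 2) ^ (m + 1) := by rw [hN]; ring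
  have hmain : ∀ n : ℕ, u n ≤ K * (n + 1) ^ (m + 1) := by
    intro n
    induction n with
    | zero =>
      rw [Nat.cast_zero, zero_add, one_pow, mul_one]
      exact (le_max_right 0 (u 0)).trans (le_max_left _ _)
    | succ n ih =>
      refine ((hu n).trans (step n ih)).trans (le_of_eq ?_)
      push_cast
      ring
  exact ⟨K, hK0, fun n => ⟨hmain n, step n (hmain n)⟩⟩

namespace PolyaUrn

variable {q : ℕ} {U : PolyaUrn q}
  {Ω : Type*} [MeasurableSpace Ω] {μ : Measure Ω} [IsProbabilityMeasure μ]
  {X : ℕ → Ω → EuclideanSpace ℝ (Fin q)}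
  {H : Type} [NormedAddCommGroup H] [InnerProductSpace ℝ H]
  {Λ : EuclideanSpace ℝ (Fin q) →L[ℝ] H} {v : EuclideanSpace ℝ (Fin q)} {b κ : ℝ}

/-- Along one step of the urn the mean of an even power of the distance to the line `N ↦ N b v`
obeys the bound that the drift suggests, up to lower order terms. -/
theorem exists_integral_stepKernel_pow_le [CompleteSpace H]
    (hmom : ∀ i (k : ℕ), Integrable (fun y => ‖y‖ ^ k)
      (U.replacement i : Measure (EuclideanSpace ℝ (Fin q))))
    (hdrift : ∀ x, (∀ i, 0 ≤ x i) → 0 < U.totalActivity x → ∀ N : ℝ, 0 < N →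
        inner ℝ (Λ (x - (N * b) • v)) (Λ (U.drift x - b • v))
          ≤ κ / N * ‖Λ (x - (N * b) • v)‖ ^ 2) (m : ℕ) :
    ∃ C : ℝ, 0 ≤ C ∧ ∀ x ∈ U.activeCompositions, ∀ N : ℝ, 0 < N →
      ∫ y, ‖Λ (x + y - ((N + 1) * b) • v)‖ ^ (2 * (m + 1)) ∂U.stepKernel x
        ≤ (1 + (m + 1) * (2 * κ) / N) * ‖Λ (x - (N * b) • v)‖ ^ (2 * (m + 1))
          + C * (‖Λ (x - (N * b) • v)‖ ^ (2 * m) + 1) := by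
  obtain ⟨C, hC, hTaylor⟩ := exists_norm_add_pow_le m
  have hDint : ∀ (k : ℕ) i, Integrable (fun y => ‖Λ (y - b • v)‖ ^ k)
      (U.replacement i : Measure (EuclideanSpace ℝ (Fin q))) := by
    intro k i
    refine integrable_comp_of_norm_le_pow (Z := id) measurable_id (hmom i)
      (g := fun y => ‖Λ (y - b • v)‖ ^ k) (by fun_prop) ((‖Λ‖ * (1 + ‖b • v‖)) ^ k) k fun y => ?_
    rw [← mul_pow, norm_pow, norm_norm]
    gcongr
    refine (Λ.le_opNorm _).trans ?_
    rw [mul_assoc]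
    gcongr
    refine (norm_sub_le _ _).trans ?_
    nlinarith [norm_nonneg y, norm_nonneg (b • v)]
  have hid : ∀ i, Integrable id (U.replacement i : Measure (EuclideanSpace ℝ (Fin q))) :=
    fun i => (integrable_norm_iff aestronglyMeasurable_id).mp (by simpa using hmom i 1)
  set M : ℕ → ℝ := fun k => ∑ i, ∫ y, ‖Λ (y - b • v)‖ ^ k
    ∂(U.replacement i : Measure (EuclideanSpace ℝ (Fin q))) with hM
  have hM0 : ∀ k, 0 ≤ M k := fun k =>
    Finset.sum_nonneg fun i _ => integral_nonneg fun y => by positivity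
  refine ⟨C * (M 2 + M (2 * (m + 1))), mul_nonneg hC (add_nonneg (hM0 _) (hM0 _)),
    fun x hx N hN => ?_⟩
  set z := Λ (x - (N * b) • v) with hz
  have hsplit : ∀ y, Λ (x + y - ((N + 1) * b) • v) = z + Λ (y - b • v) := by
    intro y
    rw [hz, ← map_add]
    congr 1
    rw [add_mul, one_mul, add_smul]
    abel
  have hDk : ∀ k, Integrable (fun y => ‖Λ (y - b • v)‖ ^ k) (U.stepKernel x) := fun k =>
    integrable_stepKernel (hDint k) x
  have hxid : Integrable (fun y => y) (U.stepKernel x) := integrable_stepKernel hid x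
  have hyint : Integrable (fun y => y - b • v) (U.stepKernel x) :=
    hxid.sub (integrable_const (b • v))
  have hmean : ∫ y, Λ (y - b • v) ∂U.stepKernel x = Λ (U.drift x - b • v) := by
    rw [Λ.integral_comp_comm hyint, integral_sub hxid (integrable_const _), integral_const,
      probReal_univ, one_smul, integral_stepKernel (g := fun y => y) hid hx]
    rfl
  have hI1 : Integrable (fun y => 2 * ((m : ℝ) + 1) * ‖z‖ ^ (2 * m) * inner ℝ z (Λ (y - b • v)))
      (U.stepKernel x) := ((Λ.integrable_comp hyint).const_inner z).const_mul _
  have hI01 : Integrable (fun y => ‖z‖ ^ (2 * (m + 1))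
      + 2 * ((m : ℝ) + 1) * ‖z‖ ^ (2 * m) * inner ℝ z (Λ (y - b • v))) (U.stepKernel x) :=
    (integrable_const _).add hI1
  have hI2 : Integrable (fun y => C * (‖z‖ ^ (2 * m) * ‖Λ (y - b • v)‖ ^ 2
      + ‖Λ (y - b • v)‖ ^ (2 * (m + 1)))) (U.stepKernel x) :=
    (((hDk 2).const_mul _).add (hDk _)).const_mul C
  have hle : ∫ y, ‖Λ (x + y - ((N + 1) * b) • v)‖ ^ (2 * (m + 1)) ∂U.stepKernel x
      ≤ ∫ y, (‖z‖ ^ (2 * (m + 1)) + 2 * ((m : ℝ) + 1) * ‖z‖ ^ (2 * m) * inner ℝ z (Λ (y - b • v))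
        + C * (‖z‖ ^ (2 * m) * ‖Λ (y - b • v)‖ ^ 2 + ‖Λ (y - b • v)‖ ^ (2 * (m + 1))))
        ∂U.stepKernel x := by
    refine integral_mono_of_nonneg (Eventually.of_forall fun y => by positivity)
      (hI01.add hI2) (Eventually.of_forall fun y => ?_)
    simp only [hsplit]
    exact hTaylor z (Λ (y - b • v))
  refine hle.trans ?_
  rw [integral_add hI01 hI2, integral_add (integrable_const _) hI1,
    integral_const, probReal_univ, one_smul, integral_const_mul, integral_const_mul,
    integral_add ((hDk 2).const_mul _) (hDk _), integral_const_mul,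
    integral_inner (Λ.integrable_comp hyint), hmean]
  have k1 := hdrift x hx.1 hx.2 N hN
  have k2 := integral_stepKernel_le (fun y => by positivity) (hDint 2) hx
  have k3 := integral_stepKernel_le (fun y => by positivity) (hDint (2 * (m + 1))) hx
  have hz0 : 0 ≤ ‖z‖ ^ (2 * m) := by positivity
  calc _ ≤ ‖z‖ ^ (2 * (m + 1)) + 2 * (m + 1) * ‖z‖ ^ (2 * m) * (κ / N * ‖z‖ ^ 2)
        + C * (‖z‖ ^ (2 * m) * M 2 + M (2 * (m + 1))) := by gcongr
    _ = (1 + (m + 1) * (2 * κ) / N) * ‖z‖ ^ (2 * (m + 1))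
        + C * (‖z‖ ^ (2 * m) * M 2 + M (2 * (m + 1))) := by ring
    _ ≤ _ := by
        rw [mul_assoc C]
        gcongr
        nlinarith [hM0 2, hM0 (2 * (m + 1)), mul_nonneg hz0 (hM0 (2 * (m + 1)))]

/-- Extinction is absorbing. -/
theorem ae_eq_of_extinct (hX : U.IsUrnEvolution μ X) (ht : IsTenable μ X) (n : ℕ) :
    ∀ᵐ ω ∂μ, X n ω ∉ U.activeCompositions → X (n + 1) ω = X n ω := by
  have hm := hX.measurable
  have hpair : Measurable fun ω => (X n ω, X (n + 1) ω - X n ω) :=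
    (hm n).prodMk ((hm (n + 1)).sub (hm n))
  have : IsProbabilityMeasure (μ.map (X n)) :=
    Measure.isProbabilityMeasure_map (hm n).aemeasurable
  have hA := U.measurableSet_activeCompositions.compl
  have hB : MeasurableSet ({0}ᶜ : Set (EuclideanSpace ℝ (Fin q))) :=
    (measurableSet_singleton 0).compl
  have h0 : μ.map (fun ω => (X n ω, X (n + 1) ω - X n ω)) (U.activeCompositionsᶜ ×ˢ {0}ᶜ) = 0 := by
    rw [map_increment_eq_compProd hX ht n, Measure.compProd_apply_prod hA hB]
    refine (setLIntegral_congr_fun hA fun x hx => ?_).trans (lintegral_zero)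
    rw [stepKernel_apply_of_notMem hx, Measure.dirac_apply' _ hB]
    simp
  rw [Measure.map_apply hpair (hA.prod hB)] at h0
  filter_upwards [measure_eq_zero_iff_ae_notMem.mp h0] with ω hω hn
  by_contra hne
  exact hω ⟨hn, fun h => hne (sub_eq_zero.mp h)⟩

theorem activeCompositions_antitone (hX : U.IsUrnEvolution μ X) (ht : IsTenable μ X) (n : ℕ) :
    X (n + 1) ⁻¹' U.activeCompositions ≤ᵐ[μ] X n ⁻¹' U.activeCompositions := by
  filter_upwards [ae_eq_of_extinct hX ht n] with ω hω h
  have h' : X (n + 1) ω ∈ U.activeCompositions := h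
  change X n ω ∈ U.activeCompositions
  by_contra hn
  exact hn (hω hn ▸ h')

theorem integrable_dist_pow (hX : U.IsUrnEvolution μ X) (ht : IsTenable μ X)
    (hmom : ∀ i (k : ℕ), Integrable (fun y => ‖y‖ ^ k)
      (U.replacement i : Measure (EuclideanSpace ℝ (Fin q)))) (n k : ℕ)
    (c : EuclideanSpace ℝ (Fin q)) : Integrable (fun ω => ‖Λ (X n ω - c)‖ ^ k) μ := by
  refine integrable_comp_of_norm_le_pow (hX.measurable n)
    (integrable_composition_pow hX ht hmom n)
    (g := fun y => ‖Λ (y - c)‖ ^ k) (by fun_prop) ((‖Λ‖ * (1 + ‖c‖)) ^ k) k fun y => ?_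
  rw [← mul_pow, norm_pow, norm_norm]
  gcongr
  refine (Λ.le_opNorm _).trans ?_
  rw [mul_assoc]
  gcongr
  refine (norm_sub_le _ _).trans ?_
  nlinarith [norm_nonneg y, norm_nonneg c]

/-- As long as the urn has not died out, its composition stays within distance of order `√n` of
the line `n ↦ n b v`, in every moment. -/
theorem exists_moment_bound [CompleteSpace H] (hX : U.IsUrnEvolution μ X) (ht : IsTenable μ X)
    (hmom : ∀ i (k : ℕ), Integrable (fun y => ‖y‖ ^ k)
      (U.replacement i : Measure (EuclideanSpace ℝ (Fin q)))) (hκ0 : 0 ≤ κ) (hκ : κ < 1 / 2)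
    (hdrift : ∀ x, (∀ i, 0 ≤ x i) → 0 < U.totalActivity x → ∀ N : ℝ, 0 < N →
        inner ℝ (Λ (x - (N * b) • v)) (Λ (U.drift x - b • v))
          ≤ κ / N * ‖Λ (x - (N * b) • v)‖ ^ 2) (m : ℕ) :
    ∃ K : ℝ, 0 ≤ K ∧ ∀ n : ℕ,
      ∫ ω in X n ⁻¹' U.activeCompositions, ‖Λ (X n ω - ((n + 1) * b) • v)‖ ^ (2 * m) ∂μ
        ≤ K * (n + 1) ^ m ∧
      ∫ ω in X n ⁻¹' U.activeCompositions, ‖Λ (X (n + 1) ω - ((n + 2) * b) • v)‖ ^ (2 * m) ∂μ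
        ≤ K * (n + 2) ^ m := by
  induction m with
  | zero =>
    refine ⟨1, zero_le_one, fun n => ?_⟩
    simp [measureReal_le_one]
  | succ m ih =>
    obtain ⟨K, hK, hKn⟩ := ih
    obtain ⟨C, hC, hstep⟩ := exists_integral_stepKernel_pow_le hmom hdrift m
    have hA : ∀ n, MeasurableSet (X n ⁻¹' U.activeCompositions) := fun n =>
      hX.measurable n U.measurableSet_activeCompositions
    refine exists_growth_bound (θ := 2 * κ) (C := C * (K + 1)) m (by positivity) (by linarith)
      (fun n => ?_) fun n => ?_
    · set N : ℝ := n + 1 with hN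
      have hN0 : 0 < N := by positivity
      have hN2 : (n + 2 : ℝ) = N + 1 := by rw [hN]; ring
      have hI : ∀ k : ℕ, Integrable (fun ω => ‖Λ (X n ω - (N * b) • v)‖ ^ k)
          (μ.restrict (X n ⁻¹' U.activeCompositions)) := fun k =>
        (integrable_dist_pow hX ht hmom n k _).restrict
      have hI1 : Integrable (fun ω => C * (‖Λ (X n ω - (N * b) • v)‖ ^ (2 * m) + 1))
          (μ.restrict (X n ⁻¹' U.activeCompositions)) :=
        ((hI _).add (integrable_const _)).const_mul _
      let g : EuclideanSpace ℝ (Fin q) × EuclideanSpace ℝ (Fin q) → ℝ :=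
        (U.activeCompositions ×ˢ Set.univ).indicator
          fun p => ‖Λ (p.1 + p.2 - ((N + 1) * b) • v)‖ ^ (2 * (m + 1))
      have hg : Measurable g := Measurable.indicator (Continuous.measurable (by fun_prop))
        (U.measurableSet_activeCompositions.prod .univ)
      have hgX : (fun ω => g (X n ω, X (n + 1) ω - X n ω))
          = (X n ⁻¹' U.activeCompositions).indicator
            fun ω => ‖Λ (X (n + 1) ω - ((N + 1) * b) • v)‖ ^ (2 * (m + 1)) := by
        ext ω
        by_cases h : X n ω ∈ U.activeCompositions <;> simp [g, h]
      have hgint : Integrable (fun ω => g (X n ω, X (n + 1) ω - X n ω)) μ := by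
        rw [hgX]
        exact (integrable_dist_pow hX ht hmom (n + 1) _ _).indicator (hA n)
      have hw := integral_increment hX ht n hg hgint
      rw [hgX, integral_indicator (hA n)] at hw
      have hinner : (fun ω => ∫ y, g (X n ω, y) ∂U.stepKernel (X n ω))
          = (X n ⁻¹' U.activeCompositions).indicator fun ω =>
            ∫ y, ‖Λ (X n ω + y - ((N + 1) * b) • v)‖ ^ (2 * (m + 1)) ∂U.stepKernel (X n ω) := by
        ext ω
        by_cases h : X n ω ∈ U.activeCompositions <;> simp [g, h]
      rw [hinner, integral_indicator (hA n)] at hw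
      rw [hN2, hw]
      calc _ ≤ ∫ ω in X n ⁻¹' U.activeCompositions,
            ((1 + (m + 1) * (2 * κ) / N) * ‖Λ (X n ω - (N * b) • v)‖ ^ (2 * (m + 1))
              + C * (‖Λ (X n ω - (N * b) • v)‖ ^ (2 * m) + 1)) ∂μ := by
            refine integral_mono_of_nonneg
              (Eventually.of_forall fun ω => integral_nonneg fun y => by positivity)
              (((hI _).const_mul _).add hI1) ?_
            exact (ae_restrict_iff' (hA n)).mpr
              (Eventually.of_forall fun ω hω => hstep _ hω N hN0)
        _ = (1 + (m + 1) * (2 * κ) / N) * ∫ ω in X n ⁻¹' U.activeCompositions,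
              ‖Λ (X n ω - (N * b) • v)‖ ^ (2 * (m + 1)) ∂μ
            + C * (∫ ω in X n ⁻¹' U.activeCompositions,
              ‖Λ (X n ω - (N * b) • v)‖ ^ (2 * m) ∂μ
              + μ.real (X n ⁻¹' U.activeCompositions)) := by
            rw [integral_add ((hI _).const_mul _) hI1, integral_const_mul,
              integral_const_mul, integral_add (hI _) (integrable_const _), integral_const]
            simp
        _ ≤ _ := by
            rw [mul_assoc C]
            gcongr
            have h1 : (1 : ℝ) ≤ N ^ m := one_le_pow₀ (by rw [hN]; linarith [n.cast_nonneg (α := ℝ)])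
            have h2 : μ.real (X n ⁻¹' U.activeCompositions) ≤ 1 := measureReal_le_one
            linarith [(hKn n).1]
    · have hcast : ((n + 1 : ℕ) : ℝ) + 1 = n + 2 := by push_cast; ring
      rw [hcast]
      exact setIntegral_mono_set (integrable_dist_pow hX ht hmom (n + 1) _ _).integrableOn
        (Eventually.of_forall fun ω => by positivity) (activeCompositions_antitone hX ht n)

end PolyaUrn

/-! ### Survival -/

namespace PolyaUrn

variable {q : ℕ} {U : PolyaUrn q} {Ω : Type*} {X : ℕ → Ω → EuclideanSpace ℝ (Fin q)}

theorem nonExtinctUpTo_antitone : Antitone (U.nonExtinctUpTo X) :=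
  fun _ _ hmn _ hω k hk => hω k (hk.trans hmn)

variable [MeasurableSpace Ω] {μ : Measure Ω}

theorem measurableSet_preimage_active (hX : U.IsUrnEvolution μ X) (n : ℕ) :
    MeasurableSet (X n ⁻¹' U.activeCompositions) :=
  hX.measurable n U.measurableSet_activeCompositions

theorem measurableSet_nonExtinctUpTo (hX : U.IsUrnEvolution μ X) (n : ℕ) :
    MeasurableSet (U.nonExtinctUpTo X n) := by
  have : U.nonExtinctUpTo X n = ⋂ k, ⋂ _ : k ≤ n, {ω | 0 < U.totalActivity (X k ω)} := by
    ext ω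
    simp [nonExtinctUpTo]
  rw [this]
  exact MeasurableSet.iInter fun k => MeasurableSet.iInter fun _ => measurableSet_lt
    measurable_const (U.continuous_totalActivity.measurable.comp (hX.measurable k))

theorem measurableSet_nonExtinct (hX : U.IsUrnEvolution μ X) : MeasurableSet (U.nonExtinct X) :=
  MeasurableSet.iInter fun n => measurableSet_nonExtinctUpTo hX n

variable [IsProbabilityMeasure μ] {v : EuclideanSpace ℝ (Fin q)} {b : ℝ}

/-- The bounds of `exists_moment_bound` in the Euclidean norm of the compositions. -/
theorem exists_moment_bound_norm {ev : Fin q → ℂ} {i₀ i₁ : Fin q} (hi₀ : (i₀ : ℕ) = 0)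
    (hi₁ : (i₁ : ℕ) = 1) (hX : U.IsUrnEvolution μ X)
    (ht : IsTenable μ X) (hev : U.IsEigenvalueOrdering ev) (hb : U.IsBalancedInExpectation b)
    (hmom : ∀ i (k : ℕ), Integrable (fun y => ‖y‖ ^ k)
      (U.replacement i : Measure (EuclideanSpace ℝ (Fin q))))
    (hev0 : ev i₀ = b) (hsmall : 2 * (ev i₁).re < b) :
    ∃ v : EuclideanSpace ℝ (Fin q), U.totalActivity v = 1 ∧ ∀ m : ℕ, ∃ K : ℝ, 0 ≤ K ∧ ∀ n : ℕ,
      ∫ ω in X n ⁻¹' U.activeCompositions, ‖X n ω - ((n + 1) * b) • v‖ ^ (2 * m) ∂μ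
        ≤ K * (n + 1) ^ m ∧
      ∫ ω in X n ⁻¹' U.activeCompositions, ‖X (n + 1) ω - ((n + 2) * b) • v‖ ^ (2 * m) ∂μ
        ≤ K * (n + 2) ^ m := by
  have hid : ∀ i, Integrable id (U.replacement i : Measure (EuclideanSpace ℝ (Fin q))) :=
    fun i => (integrable_norm_iff aestronglyMeasurable_id).mp (by simpa using hmom i 1)
  obtain ⟨ι, _, Λ, v, κ, hv, hinj, hκ0, hκ, hdrift⟩ :=
    exists_drift_form hi₀ hi₁ hev hb hid hev0 hsmall
  obtain ⟨c, -, hc⟩ := (Λ : EuclideanSpace ℝ (Fin q) →ₗ[ℝ] EuclideanSpace ℂ ι)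
    |>.exists_antilipschitzWith (LinearMap.ker_eq_bot.mpr hinj)
  have hcle : ∀ (x : EuclideanSpace ℝ (Fin q)) (k : ℕ), ‖x‖ ^ k ≤ (c : ℝ) ^ k * ‖Λ x‖ ^ k := by
    intro x k
    rw [← mul_pow]
    gcongr
    simpa using hc.le_mul_dist x 0
  refine ⟨v, hv, fun m => ?_⟩
  obtain ⟨K, hK, hKn⟩ := exists_moment_bound hX ht hmom hκ0 hκ hdrift m
  refine ⟨(c : ℝ) ^ (2 * m) * K, by positivity, fun n => ?_⟩
  have hle : ∀ (k : ℕ) (z : EuclideanSpace ℝ (Fin q)),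
      ∫ ω in X n ⁻¹' U.activeCompositions, ‖X k ω - z‖ ^ (2 * m) ∂μ ≤
      (c : ℝ) ^ (2 * m) * ∫ ω in X n ⁻¹' U.activeCompositions, ‖Λ (X k ω - z)‖ ^ (2 * m) ∂μ := by
    intro k z
    rw [← integral_const_mul]
    exact integral_mono_of_nonneg (Eventually.of_forall fun ω => by positivity)
      ((integrable_dist_pow hX ht hmom k _ z).restrict.const_mul _)
      (Eventually.of_forall fun ω => hcle _ _)
  constructor
  · refine (hle _ _).trans ?_
    rw [mul_assoc]
    gcongr
    exact (hKn n).1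
  · refine (hle _ _).trans ?_
    rw [mul_assoc]
    gcongr
    exact (hKn n).2

theorem nonExtinctUpTo_ae_eq (hX : U.IsUrnEvolution μ X) (ht : IsTenable μ X) (n : ℕ) :
    U.nonExtinctUpTo X n =ᵐ[μ] X n ⁻¹' U.activeCompositions := by
  refine Filter.eventuallyEq_set.mpr ?_
  filter_upwards [ae_all_iff.mpr ht, ae_all_iff.mpr fun n => ae_eq_of_extinct hX ht n]
    with ω hpos habs
  have hprev : ∀ k, X (k + 1) ω ∈ U.activeCompositions → X k ω ∈ U.activeCompositions := by
    intro k hk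
    by_contra hn
    exact hn (habs k hn ▸ hk)
  constructor
  · intro h
    exact ⟨hpos n, h n le_rfl⟩
  · intro h k hk
    have : X k ω ∈ U.activeCompositions :=
      Nat.decreasingInduction' (P := fun j => X j ω ∈ U.activeCompositions)
        (fun j _ _ hj => hprev j hj) hk h
    exact this.2

/-- By Markov's inequality, the moment bound of order `2 m` makes the probability that the urn dies
at time `n + 1` of order `n ^ (-m)`, since dying then is a deviation of order `n` from the line. -/
theorem exists_extinction_bound (hX : U.IsUrnEvolution μ X) (ht : IsTenable μ X) (hb : 0 < b)
    (hmom : ∀ i (k : ℕ), Integrable (fun y => ‖y‖ ^ k)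
      (U.replacement i : Measure (EuclideanSpace ℝ (Fin q))))
    (hv : U.totalActivity v = 1) {m : ℕ} {K : ℝ} (hK : ∀ n : ℕ,
      ∫ ω in X n ⁻¹' U.activeCompositions, ‖X (n + 1) ω - ((n + 2) * b) • v‖ ^ (2 * m) ∂μ
        ≤ K * (n + 2) ^ m) :
    ∃ C : ℝ, 0 ≤ C ∧ ∀ n : ℕ, μ.real (X n ⁻¹' U.activeCompositions)
      - μ.real (X (n + 1) ⁻¹' U.activeCompositions) ≤ C / (n + 2) ^ m := by
  have hK0 : 0 ≤ K := by
    have h1 : 0 ≤ K * ((0 : ℕ) + 2) ^ m :=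
      (integral_nonneg fun ω => by positivity).trans (hK 0)
    exact nonneg_of_mul_nonneg_left h1 (by positivity)
  set L := ‖U.totalActivityL‖ + 1 with hL
  have hL0 : 0 < L := by positivity
  refine ⟨(L / b) ^ (2 * m) * K, by positivity, fun n => ?_⟩
  set A := X n ⁻¹' U.activeCompositions with hA
  set A' := X (n + 1) ⁻¹' U.activeCompositions with hA'
  have hAm : MeasurableSet A := measurableSet_preimage_active hX n
  have hA'm : MeasurableSet A' := measurableSet_preimage_active hX (n + 1)
  have h1 : μ.real A - μ.real A' ≤ μ.real (A \ A') := by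
    linarith [measureReal_sdiff_add_inter (μ := μ) (s := A) hA'm,
      measureReal_mono (μ := μ) (Set.inter_subset_right : A ∩ A' ⊆ A')]
  refine h1.trans ?_
  have hint : Integrable (fun ω => ‖X (n + 1) ω - ((n + 2) * b) • v‖ ^ (2 * m)) μ :=
    integrable_dist_pow (Λ := ContinuousLinearMap.id ℝ _) hX ht hmom (n + 1) (2 * m) _
  have hn2 : (0 : ℝ) < n + 2 := by positivity
  have h2 : ((n + 2) * b / L) ^ (2 * m) * μ.real (A \ A') ≤ K * (n + 2) ^ m := by
    calc ((n + 2) * b / L) ^ (2 * m) * μ.real (A \ A')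
        = ∫ ω in A \ A', ((n + 2) * b / L) ^ (2 * m) ∂μ := by
          rw [integral_const, smul_eq_mul, measureReal_restrict_apply_univ, mul_comm]
      _ ≤ ∫ ω in A \ A', ‖X (n + 1) ω - ((n + 2) * b) • v‖ ^ (2 * m) ∂μ := by
          refine setIntegral_mono_on_ae (integrable_const _).integrableOn hint.integrableOn
            (hAm.diff hA'm) ?_
          filter_upwards [ht (n + 1)] with ω hω hmem
          have hS : U.totalActivity (X (n + 1) ω) ≤ 0 := by
            by_contra! h
            exact hmem.2 ⟨hω, h⟩
          gcongr
          rw [div_le_iff₀ hL0]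
          have h3 := U.totalActivityL.le_opNorm (X (n + 1) ω - ((n + 2) * b) • v)
          rw [map_sub, map_smul, totalActivityL_apply, totalActivityL_apply, hv, smul_eq_mul,
            mul_one, Real.norm_eq_abs] at h3
          calc (n + 2) * b ≤ |U.totalActivity (X (n + 1) ω) - (n + 2) * b| := by
                rw [abs_sub_comm]
                exact le_trans (by linarith) (le_abs_self _)
            _ ≤ _ := h3
            _ ≤ _ := by
                rw [mul_comm]
                gcongr
                rw [hL]
                linarith
      _ ≤ ∫ ω in A, ‖X (n + 1) ω - ((n + 2) * b) • v‖ ^ (2 * m) ∂μ :=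
          setIntegral_mono_set hint.integrableOn (Eventually.of_forall fun ω => by positivity)
            (Eventually.of_forall Set.sdiff_subset)
      _ ≤ _ := hK n
  rw [le_div_iff₀ (by positivity)]
  have h4 : ((n + 2) * b / L) ^ (2 * m) = (n + 2 : ℝ) ^ m * (n + 2) ^ m / (L / b) ^ (2 * m) := by
    rw [eq_div_iff (by positivity), ← mul_pow]
    have : (n + 2) * b / L * (L / b) = (n + 2 : ℝ) := by field_simp
    rw [this, ← pow_add, two_mul]
  rw [h4, div_mul_eq_mul_div, div_le_iff₀ (by positivity)] at h2
  have h5 : (0 : ℝ) < (n + 2) ^ m := by positivity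
  refine le_of_mul_le_mul_right ?_ h5
  calc _ = (n + 2 : ℝ) ^ m * (n + 2) ^ m * μ.real (A \ A') := by ring
    _ ≤ _ := h2
    _ = _ := by ring

/-- A sequence tending to zero with decrements of order `n⁻⁴` is of order `n⁻³`. -/
theorem le_of_sub_le_of_tendsto_zero {p : ℕ → ℝ} {C : ℝ} (hC : 0 ≤ C)
    (hp : ∀ n : ℕ, p n - p (n + 1) ≤ C / (n + 2) ^ 4) (h0 : Tendsto p atTop (𝓝 0)) (n : ℕ) :
    p n ≤ C / (n + 1) ^ 3 := by
  have hmono : Monotone fun n : ℕ => p n - C / (n + 1 : ℝ) ^ 3 := by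
    refine monotone_nat_of_le_succ fun n => ?_
    have h1 := hp n
    have h2 : C / (n + 2 : ℝ) ^ 4 ≤ C / (n + 1 : ℝ) ^ 3 - C / (n + 2) ^ 3 := by
      have h3 : (1 : ℝ) / (n + 2) ^ 4 ≤ 1 / (n + 1) ^ 3 - 1 / (n + 2) ^ 3 := by
        rw [div_sub_div _ _ (by positivity) (by positivity),
          div_le_div_iff₀ (by positivity) (by positivity)]
        have hn : (0 : ℝ) ≤ n := n.cast_nonneg
        have : (0 : ℝ) ≤ (n + 2) ^ 3 * ((n + 2) * ((n + 2) ^ 3 - (n + 1) ^ 3) - (n + 1) ^ 3) := by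
          refine mul_nonneg (by positivity) ?_
          ring_nf
          positivity
        nlinarith
      calc C / (n + 2 : ℝ) ^ 4 = C * (1 / (n + 2) ^ 4) := by ring
        _ ≤ C * (1 / (n + 1) ^ 3 - 1 / (n + 2) ^ 3) := by gcongr
        _ = _ := by ring
    push_cast
    rw [show (n + 1 + 1 : ℝ) = n + 2 by ring]
    linarith
  have hlim : Tendsto (fun n : ℕ => p n - C / (n + 1 : ℝ) ^ 3) atTop (𝓝 0) := by
    have h1 : Tendsto (fun n : ℕ => C / (n + 1 : ℝ) ^ 3) atTop (𝓝 0) := by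
      refine Tendsto.div_atTop tendsto_const_nhds ?_
      exact (tendsto_pow_atTop (by norm_num)).comp
        (tendsto_atTop_add_const_right _ 1 tendsto_natCast_atTop_atTop)
    simpa using h0.sub h1
  linarith [hmono.ge_of_tendsto hlim n]

/-- The mean total activity never falls below its initial value. -/
theorem init_totalActivity_le (hX : U.IsUrnEvolution μ X) (ht : IsTenable μ X)
    (hb : U.IsBalancedInExpectation b)
    (hmom : ∀ i (k : ℕ), Integrable (fun y => ‖y‖ ^ k)
      (U.replacement i : Measure (EuclideanSpace ℝ (Fin q)))) (n : ℕ) :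
    U.totalActivity U.init ≤ ∫ ω, U.totalActivity (X n ω) ∂μ := by
  have hid : ∀ i, Integrable id (U.replacement i : Measure (EuclideanSpace ℝ (Fin q))) :=
    fun i => (integrable_norm_iff aestronglyMeasurable_id).mp (by simpa using hmom i 1)
  have hXint : ∀ n, Integrable (X n) μ := fun n =>
    (integrable_norm_iff (hX.measurable n).aestronglyMeasurable).mp
      (by simpa using integrable_composition_pow hX ht hmom n 1)
  have hSint : ∀ n, Integrable (fun ω => U.totalActivity (X n ω)) μ := fun n => by
    simpa using U.totalActivityL.integrable_comp (hXint n)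
  induction n with
  | zero =>
    rw [integral_congr_ae (hX.init_eq.mono fun ω h => by rw [h]), integral_const, probReal_univ,
      one_smul]
  | succ n ih =>
    have hΔ : ∀ ω, U.totalActivity (X (n + 1) ω - X n ω)
        = U.totalActivity (X (n + 1) ω) - U.totalActivity (X n ω) := fun ω => by
      simp [← totalActivityL_apply]
    have h1 := integral_increment hX ht n
      (g := fun p => U.totalActivity p.2)
      (U.continuous_totalActivity.measurable.comp measurable_snd)
      (by simp only [hΔ]; exact (hSint _).sub (hSint _))
    simp only [hΔ] at h1
    rw [integral_sub (hSint _) (hSint _)] at h1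
    have h2 : 0 ≤ ∫ ω, ∫ y, U.totalActivity y ∂U.stepKernel (X n ω) ∂μ := by
      refine integral_nonneg fun ω => ?_
      by_cases hω : X n ω ∈ U.activeCompositions
      · have : ∫ y, U.totalActivity y ∂U.stepKernel (X n ω) = b := by
          have h3 := U.totalActivityL.integral_comp_comm
            (integrable_stepKernel (g := fun y => y) hid (X n ω))
          rw [integral_stepKernel (g := fun y => y) hid hω] at h3
          simp only [totalActivityL_apply] at h3
          rw [h3]
          exact totalActivity_drift hb hid hω.2
        simp only [Pi.zero_apply]
        rw [this]
        exact hb.1.le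
      · rw [stepKernel_apply_of_notMem hω, integral_dirac]
        simp [totalActivity]
    linarith

theorem tendsto_measureReal_nonExtinctUpTo (hX : U.IsUrnEvolution μ X) :
    Tendsto (fun n => μ.real (U.nonExtinctUpTo X n)) atTop (𝓝 (μ.real (U.nonExtinct X))) := by
  refine (ENNReal.tendsto_toReal (measure_ne_top _ _)).comp ?_
  exact tendsto_measure_iInter_atTop
    (fun n => (measurableSet_nonExtinctUpTo hX n).nullMeasurableSet) nonExtinctUpTo_antitone
    ⟨0, measure_ne_top _ _⟩

/-- The urn survives with positive probability. Otherwise the survival probability would decay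
fast, and as the second moment of the total activity grows only quadratically, its mean would
tend to zero. -/
theorem measureReal_nonExtinct_pos (hX : U.IsUrnEvolution μ X) (ht : IsTenable μ X)
    (hb : U.IsBalancedInExpectation b)
    (hmom : ∀ i (k : ℕ), Integrable (fun y => ‖y‖ ^ k)
      (U.replacement i : Measure (EuclideanSpace ℝ (Fin q))))
    (hv : U.totalActivity v = 1) (hbound : ∀ m : ℕ, ∃ K : ℝ, 0 ≤ K ∧ ∀ n : ℕ,
      ∫ ω in X n ⁻¹' U.activeCompositions, ‖X n ω - ((n + 1) * b) • v‖ ^ (2 * m) ∂μ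
        ≤ K * (n + 1) ^ m ∧
      ∫ ω in X n ⁻¹' U.activeCompositions, ‖X (n + 1) ω - ((n + 2) * b) • v‖ ^ (2 * m) ∂μ
        ≤ K * (n + 2) ^ m) :
    0 < μ.real (U.nonExtinct X) := by
  by_contra hneg
  have hzero : μ.real (U.nonExtinct X) = 0 := le_antisymm (not_lt.mp hneg) measureReal_nonneg
  set p : ℕ → ℝ := fun n => μ.real (X n ⁻¹' U.activeCompositions) with hp
  have hp0 : Tendsto p atTop (𝓝 0) := by
    rw [← hzero]
    refine (tendsto_measureReal_nonExtinctUpTo hX).congr fun n => ?_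
    exact measureReal_congr (nonExtinctUpTo_ae_eq hX ht n)
  obtain ⟨K₄, -, hK₄⟩ := hbound 4
  obtain ⟨C, hC, hCn⟩ := exists_extinction_bound hX ht hb.1 hmom hv fun n => (hK₄ n).2
  have hdecay := le_of_sub_le_of_tendsto_zero hC hCn hp0
  obtain ⟨K, hK, hKn⟩ := hbound 1
  set L := ‖U.totalActivityL‖ with hL
  set S₀ := U.totalActivity U.init with hS₀
  have hS₀pos : 0 < S₀ := U.init_total_pos
  set M := 2 * L ^ 2 * K + 2 * b ^ 2 with hM
  have hb0 := hb.1
  have hM0 : 0 < M := by positivity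
  set δ := S₀ / (2 * M) with hδ
  have hδ0 : 0 < δ := by positivity
  have hkey : ∀ n : ℕ, S₀ / 2 ≤ C / (4 * δ) / (n + 1) := by
    intro n
    set N : ℝ := n + 1 with hN
    have hN1 : 1 ≤ N := by rw [hN]; linarith [n.cast_nonneg (α := ℝ)]
    have hN0 : 0 < N := by linarith
    set A := X n ⁻¹' U.activeCompositions with hA
    have hAm : MeasurableSet A := measurableSet_preimage_active hX n
    have hint : Integrable (fun ω => ‖X n ω - (N * b) • v‖ ^ (2 * 1)) (μ.restrict A) :=
      (integrable_dist_pow (Λ := ContinuousLinearMap.id ℝ _) hX ht hmom n (2 * 1) _).restrict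
    have hXint : Integrable (X n) μ :=
      (integrable_norm_iff (hX.measurable n).aestronglyMeasurable).mp
        (by simpa using integrable_composition_pow hX ht hmom n 1)
    have hSint : Integrable (fun ω => U.totalActivity (X n ω)) μ := by
      simpa using U.totalActivityL.integrable_comp hXint
    -- the total activity vanishes off `A`, and on `A` the inequality `s ≤ δ s² / N² + N² / (4 δ)`
    -- is used
    have hpt : ∀ ω, U.totalActivity (X n ω) ≤
        δ / N ^ 2 * (2 * L ^ 2 * ‖X n ω - (N * b) • v‖ ^ (2 * 1) + 2 * (N * b) ^ 2)
          + N ^ 2 / (4 * δ) := by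
      intro ω
      set s := U.totalActivity (X n ω) with hs
      have h1 : (s - N * b) ^ 2 ≤ L ^ 2 * ‖X n ω - (N * b) • v‖ ^ (2 * 1) := by
        have h3 := U.totalActivityL.le_opNorm (X n ω - (N * b) • v)
        rw [map_sub, map_smul, totalActivityL_apply, totalActivityL_apply, hv, smul_eq_mul,
          mul_one, Real.norm_eq_abs] at h3
        rw [mul_one, ← mul_pow, ← sq_abs (s - N * b)]
        gcongr
      have h2 : s ^ 2 ≤ 2 * L ^ 2 * ‖X n ω - (N * b) • v‖ ^ (2 * 1) + 2 * (N * b) ^ 2 := by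
        nlinarith [sq_nonneg (s - 2 * (N * b))]
      have h3 : δ / N ^ 2 * s ^ 2 + N ^ 2 / (4 * δ) - s
          = (δ / N ^ 2) * (s - N ^ 2 / (2 * δ)) ^ 2 := by
        field_simp
        ring
      have h4 : 0 ≤ (δ / N ^ 2) * (s - N ^ 2 / (2 * δ)) ^ 2 := by positivity
      have h5 : δ / N ^ 2 * s ^ 2 ≤ δ / N ^ 2 *
          (2 * L ^ 2 * ‖X n ω - (N * b) • v‖ ^ (2 * 1) + 2 * (N * b) ^ 2) := by gcongr
      linarith
    have hI1 : Integrable (fun ω => 2 * L ^ 2 * ‖X n ω - (N * b) • v‖ ^ (2 * 1)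
        + 2 * (N * b) ^ 2) (μ.restrict A) := (hint.const_mul _).add (integrable_const _)
    have h1 : S₀ ≤ δ / N ^ 2 * (2 * L ^ 2 * (K * N) + 2 * (N * b) ^ 2) + N ^ 2 / (4 * δ) * p n := by
      calc S₀ ≤ ∫ ω, U.totalActivity (X n ω) ∂μ := init_totalActivity_le hX ht hb hmom n
        _ ≤ ∫ ω in A, U.totalActivity (X n ω) ∂μ := by
            rw [← integral_add_compl hAm hSint]
            have : ∫ ω in Aᶜ, U.totalActivity (X n ω) ∂μ ≤ 0 := by
              refine setIntegral_nonpos_of_ae_restrict ?_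
              refine (ae_restrict_iff' hAm.compl).mpr ?_
              filter_upwards [ht n] with ω hω hmem
              by_contra! h
              exact hmem ⟨hω, h⟩
            linarith
        _ ≤ ∫ ω in A, (δ / N ^ 2 * (2 * L ^ 2 * ‖X n ω - (N * b) • v‖ ^ (2 * 1) + 2 * (N * b) ^ 2)
              + N ^ 2 / (4 * δ)) ∂μ :=
            integral_mono hSint.restrict ((hI1.const_mul _).add (integrable_const _)) hpt
        _ = δ / N ^ 2 * (2 * L ^ 2 * (∫ ω in A, ‖X n ω - (N * b) • v‖ ^ (2 * 1) ∂μ)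
              + 2 * (N * b) ^ 2 * p n) + N ^ 2 / (4 * δ) * p n := by
            rw [integral_add (hI1.const_mul _) (integrable_const _), integral_const_mul,
              integral_add (hint.const_mul _) (integrable_const _), integral_const_mul,
              integral_const, integral_const, measureReal_restrict_apply_univ, smul_eq_mul,
              smul_eq_mul, mul_comm (μ.real A), mul_comm (μ.real A)]
        _ ≤ _ := by
            have k1 := (hKn n).1
            rw [pow_one] at k1
            have k2 : 2 * (N * b) ^ 2 * p n ≤ 2 * (N * b) ^ 2 :=
              mul_le_of_le_one_right (by positivity) measureReal_le_one
            gcongr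
    have h2 : δ / N ^ 2 * (2 * L ^ 2 * (K * N) + 2 * (N * b) ^ 2) ≤ S₀ / 2 := by
      calc _ ≤ δ / N ^ 2 * (2 * L ^ 2 * (K * N ^ 2) + 2 * (N * b) ^ 2) := by
            gcongr
            nlinarith
        _ = δ * M := by
            rw [hM]
            field_simp
        _ = S₀ / 2 := by
            rw [hδ]
            field_simp
    have h3 : N ^ 2 / (4 * δ) * p n ≤ C / (4 * δ) / N := by
      calc _ ≤ N ^ 2 / (4 * δ) * (C / N ^ 3) := by
            gcongr
            exact hdecay n
        _ = _ := by field_simp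
    linarith
  have hlim : Tendsto (fun n : ℕ => C / (4 * δ) / (n + 1 : ℝ)) atTop (𝓝 0) :=
    Tendsto.div_atTop tendsto_const_nhds
      (tendsto_atTop_add_const_right _ 1 tendsto_natCast_atTop_atTop)
  linarith [ge_of_tendsto' hlim hkey]

end PolyaUrn

/-! ### Convergence of moments from convergence in distribution -/

section Truncation

variable {E : Type*} [NormedAddCommGroup E] [MeasurableSpace E] [BorelSpace E]

/-- Truncating `g` at level `K` changes its integral by at most `K⁻¹ ∫ g²`. -/
theorem abs_integral_sub_truncation_le {ρ : Measure E} [IsProbabilityMeasure ρ] {g : E → ℝ}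
    (hg : Continuous g) (hint : Integrable g ρ) (hint2 : Integrable (fun x => g x ^ 2) ρ) {K : ℝ}
    (hK : 0 < K) :
    |∫ x, g x ∂ρ - ∫ x, max (-K) (min K (g x)) ∂ρ| ≤ (∫ x, g x ^ 2 ∂ρ) / K := by
  have hT : Integrable (fun x => max (-K) (min K (g x))) ρ := by
    refine Integrable.of_bound (Continuous.aestronglyMeasurable (by fun_prop)) K
      (Eventually.of_forall fun x => ?_)
    rw [Real.norm_eq_abs, abs_le]
    exact ⟨le_max_left _ _, max_le (by linarith) (min_le_left _ _)⟩
  rw [← integral_sub hint hT, ← integral_div]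
  refine (abs_integral_le_integral_abs).trans
    (integral_mono (hint.sub hT).abs (hint2.div_const K) fun x => ?_)
  simp only
  rw [le_div_iff₀ hK]
  rcases le_total (g x) (-K) with h1 | h1
  · rw [min_eq_right (by linarith), max_eq_left h1, abs_of_nonpos (by linarith)]
    nlinarith
  · rcases le_total (g x) K with h2 | h2
    · rw [min_eq_right h2, max_eq_right h1, sub_self, abs_zero, zero_mul]
      positivity
    · rw [min_eq_left h2, max_eq_right (by linarith), abs_of_nonneg (by linarith)]
      nlinarith

variable [SecondCountableTopology E]

/-- Weak convergence together with bounds on all moments implies convergence of the integrals of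
all continuous functions of polynomial growth. -/
theorem tendsto_integral_of_moment_bound {ν : ℕ → Measure E} [∀ n, IsProbabilityMeasure (ν n)]
    {γ : Measure E} [IsProbabilityMeasure γ]
    (hlim : ∀ f : E →ᵇ ℝ, Tendsto (fun n => ∫ x, f x ∂ν n) atTop (𝓝 (∫ x, f x ∂γ)))
    (hν : ∀ n (k : ℕ), Integrable (fun x => ‖x‖ ^ k) (ν n))
    (hbound : ∀ m : ℕ, ∃ C : ℝ, ∀ n, ∫ x, ‖x‖ ^ (2 * m) ∂ν n ≤ C)
    (hγ : ∀ k : ℕ, Integrable (fun x => ‖x‖ ^ k) γ) {g : E → ℝ} (hg : Continuous g) {C : ℝ} {k : ℕ}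
    (hgC : ∀ x, ‖g x‖ ≤ C * (1 + ‖x‖) ^ k) :
    Tendsto (fun n => ∫ x, g x ∂ν n) atTop (𝓝 (∫ x, g x ∂γ)) := by
  have hg2C : ∀ x, ‖g x ^ 2‖ ≤ C ^ 2 * (1 + ‖x‖) ^ (2 * k) := by
    intro x
    rw [norm_pow, mul_comm 2 k, pow_mul, ← mul_pow]
    gcongr
    exact hgC x
  have hgν : ∀ n, Integrable g (ν n) := fun n =>
    integrable_comp_of_norm_le_pow measurable_id (hν n) hg C k hgC
  have hg2ν : ∀ n, Integrable (fun x => g x ^ 2) (ν n) := fun n =>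
    integrable_comp_of_norm_le_pow (g := fun x => g x ^ 2) measurable_id (hν n) (by fun_prop)
      _ _ hg2C
  have hgγ : Integrable g γ :=
    integrable_comp_of_norm_le_pow measurable_id hγ hg C k hgC
  have hg2γ : Integrable (fun x => g x ^ 2) γ :=
    integrable_comp_of_norm_le_pow (g := fun x => g x ^ 2) measurable_id hγ (by fun_prop) _ _ hg2C
  obtain ⟨B, hB⟩ := hbound k
  set B₁ := C ^ 2 * (2 ^ (2 * k - 1) * (1 + B)) with hB₁
  have hB₁ν : ∀ n, ∫ x, g x ^ 2 ∂ν n ≤ B₁ := by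
    intro n
    calc ∫ x, g x ^ 2 ∂ν n
        ≤ ∫ x, C ^ 2 * (2 ^ (2 * k - 1) * (1 + ‖x‖ ^ (2 * k))) ∂ν n := by
          refine integral_mono (hg2ν n)
            ((((integrable_const _).add (hν n _)).const_mul _).const_mul _) fun x => ?_
          refine (le_abs_self _).trans ((hg2C _).trans ?_)
          gcongr
          simpa using add_pow_le zero_le_one (norm_nonneg x) (2 * k)
      _ = C ^ 2 * (2 ^ (2 * k - 1) * (1 + ∫ x, ‖x‖ ^ (2 * k) ∂ν n)) := by
          rw [integral_const_mul, integral_const_mul, integral_add (integrable_const _) (hν n _)]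
          simp
      _ ≤ B₁ := by
          rw [hB₁]
          gcongr
          exact hB n
  have hB₁0 : 0 ≤ B₁ := (integral_nonneg fun x => by positivity).trans (hB₁ν 0)
  set B₂ := ∫ x, g x ^ 2 ∂γ with hB₂
  have hB₂0 : 0 ≤ B₂ := integral_nonneg fun x => by positivity
  rw [Metric.tendsto_atTop]
  intro ε hε
  set K := 2 * (B₁ + B₂ + 1) / ε with hK
  have hK0 : 0 < K := by positivity
  let T : E →ᵇ ℝ := BoundedContinuousFunction.ofNormedAddCommGroup
    (fun x => max (-K) (min K (g x))) (by fun_prop) K fun x => by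
      rw [Real.norm_eq_abs, abs_le]
      exact ⟨le_max_left _ _, max_le (by linarith) (min_le_left _ _)⟩
  obtain ⟨n₀, hn₀⟩ := Metric.tendsto_atTop.mp (hlim T) (ε / 2) (by positivity)
  refine ⟨n₀, fun n hn => ?_⟩
  have h1 := abs_integral_sub_truncation_le hg (hgν n) (hg2ν n) hK0
  have h2 := abs_integral_sub_truncation_le hg hgγ hg2γ hK0
  have h3 : |∫ x, max (-K) (min K (g x)) ∂ν n - ∫ x, max (-K) (min K (g x)) ∂γ| < ε / 2 := hn₀ n hn
  have h4 : (∫ x, g x ^ 2 ∂ν n) / K + B₂ / K < ε / 2 := by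
    calc (∫ x, g x ^ 2 ∂ν n) / K + B₂ / K ≤ B₁ / K + B₂ / K := by
          have := hB₁ν n
          gcongr
      _ < (B₁ + B₂ + 1) / K := by
          rw [← add_div, div_lt_div_iff_of_pos_right hK0]
          linarith
      _ = ε / 2 := by
          rw [hK]
          field_simp
  rw [Real.dist_eq]
  rw [abs_sub_comm] at h2
  have h5 := abs_sub_le (∫ x, g x ∂ν n) (∫ x, max (-K) (min K (g x)) ∂ν n) (∫ x, g x ∂γ)
  have h6 := abs_sub_le (∫ x, max (-K) (min K (g x)) ∂ν n) (∫ x, max (-K) (min K (g x)) ∂γ)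
    (∫ x, g x ∂γ)
  linarith

end Truncation

theorem integrable_norm_pow_multivariateGaussian {q : ℕ} (Sig : Matrix (Fin q) (Fin q) ℝ) (k : ℕ) :
    Integrable (fun x => ‖x‖ ^ k) (multivariateGaussian 0 Sig) :=
  (IsGaussian.memLp_id (multivariateGaussian 0 Sig) k (by simp)).integrable_norm_pow'

theorem norm_prod_coord_pow_le {q : ℕ} (α : Fin q → ℕ) (x : EuclideanSpace ℝ (Fin q)) :
    ‖∏ i, x i ^ α i‖ ≤ 1 * (1 + ‖x‖) ^ (∑ i, α i) := by
  rw [one_mul, norm_prod, ← Finset.prod_pow_eq_pow_sum]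
  refine Finset.prod_le_prod (fun i _ => norm_nonneg _) fun i _ => ?_
  rw [norm_pow]
  gcongr
  exact (PiLp.norm_apply_le x i).trans (by linarith)

theorem norm_rpow_norm_le {E : Type*} [NormedAddCommGroup E] {r : ℝ} (hr : 0 < r) (x : E) :
    ‖‖x‖ ^ r‖ ≤ 1 * (1 + ‖x‖) ^ ⌈r⌉₊ := by
  rw [one_mul, Real.norm_of_nonneg (by positivity), ← Real.rpow_natCast]
  have h0 := norm_nonneg x
  calc ‖x‖ ^ r ≤ (1 + ‖x‖) ^ r := by gcongr; linarith
    _ ≤ _ := Real.rpow_le_rpow_of_exponent_le (by linarith) (Nat.le_ceil r)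

section Conditional

variable {q : ℕ} {Ω : Type*} [MeasurableSpace Ω] {μ : Measure Ω} {D : ℕ → Set Ω}
  {Y : ℕ → Ω → EuclideanSpace ℝ (Fin q)} {Sig : Matrix (Fin q) (Fin q) ℝ}

/-- Conditional convergence in distribution to a normal law and bounds on all conditional moments
give convergence of the conditional integrals of functions of polynomial growth. -/
theorem CondTendstoNormal.tendsto_integral (h : CondTendstoNormal μ D Y Sig)
    (hD : ∀ n, IsProbabilityMeasure (μ[|D n])) (hY : ∀ n, Measurable (Y n))
    (hYint : ∀ n (k : ℕ), Integrable (fun ω => ‖Y n ω‖ ^ k) (μ[|D n]))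
    (hbound : ∀ m : ℕ, ∃ C : ℝ, ∀ n, ∫ ω, ‖Y n ω‖ ^ (2 * m) ∂μ[|D n] ≤ C)
    {g : EuclideanSpace ℝ (Fin q) → ℝ} (hg : Continuous g) {C : ℝ} {k : ℕ}
    (hgC : ∀ x, ‖g x‖ ≤ C * (1 + ‖x‖) ^ k) :
    Tendsto (fun n => ∫ ω, g (Y n ω) ∂μ[|D n]) atTop
      (𝓝 (∫ x, g x ∂multivariateGaussian 0 Sig)) := by
  have hmap : ∀ n {f : EuclideanSpace ℝ (Fin q) → ℝ}, Continuous f →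
      ∫ x, f x ∂(μ[|D n]).map (Y n) = ∫ ω, f (Y n ω) ∂μ[|D n] := fun n f hf =>
    integral_map (hY n).aemeasurable hf.aestronglyMeasurable
  have : ∀ n, IsProbabilityMeasure ((μ[|D n]).map (Y n)) := fun n =>
    Measure.isProbabilityMeasure_map (hY n).aemeasurable
  have key := tendsto_integral_of_moment_bound (ν := fun n => (μ[|D n]).map (Y n))
    (γ := multivariateGaussian 0 Sig)
    (fun f => (h f).congr fun n => (hmap n f.continuous).symm)
    (fun n k => (integrable_map_measure (Continuous.aestronglyMeasurable (by fun_prop))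
      (hY n).aemeasurable).mpr (hYint n k))
    (fun m => by
      obtain ⟨C, hC⟩ := hbound m
      refine ⟨C, fun n => ?_⟩
      rw [hmap n (by fun_prop)]
      exact hC n)
    (integrable_norm_pow_multivariateGaussian Sig) hg hgC
  exact key.congr fun n => hmap n hg

theorem CondTendstoNormal.condMomentsTendstoNormal (h : CondTendstoNormal μ D Y Sig)
    (hD : ∀ n, IsProbabilityMeasure (μ[|D n])) (hY : ∀ n, Measurable (Y n))
    (hYint : ∀ n (k : ℕ), Integrable (fun ω => ‖Y n ω‖ ^ k) (μ[|D n]))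
    (hbound : ∀ m : ℕ, ∃ C : ℝ, ∀ n, ∫ ω, ‖Y n ω‖ ^ (2 * m) ∂μ[|D n] ≤ C) :
    CondMomentsTendstoNormal μ D Y Sig := by
  constructor
  · intro α
    have hc : Continuous fun x : EuclideanSpace ℝ (Fin q) => ∏ i, x i ^ α i := by fun_prop
    exact ⟨fun n => integrable_comp_of_norm_le_pow (hY n) (hYint n) hc _ _
      (norm_prod_coord_pow_le α),
      h.tendsto_integral hD hY hYint hbound hc (norm_prod_coord_pow_le α)⟩
  · intro r hr
    have hc : Continuous fun x : EuclideanSpace ℝ (Fin q) => ‖x‖ ^ r :=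
      continuous_norm.rpow_const fun _ => Or.inr hr.le
    exact ⟨fun n => integrable_comp_of_norm_le_pow (hY n) (hYint n) hc _ _ (norm_rpow_norm_le hr),
      h.tendsto_integral hD hY hYint hbound hc (norm_rpow_norm_le hr)⟩

end Conditional

/-! ### Changing the conditioning event -/

section Conditioning

variable {Ω : Type*} [MeasurableSpace Ω] {μ : Measure Ω}

theorem integral_cond {F : Type*} [NormedAddCommGroup F] [NormedSpace ℝ F] (s : Set Ω)
    (f : Ω → F) : ∫ ω, f ω ∂μ[|s] = (μ.real s)⁻¹ • ∫ ω in s, f ω ∂μ := by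
  rw [ProbabilityTheory.cond, integral_smul_measure, ENNReal.toReal_inv, measureReal_def]

theorem integrable_cond {F : Type*} [NormedAddCommGroup F] {s : Set Ω} (hs : 0 < μ.real s)
    {f : Ω → F} (hf : Integrable f μ) : Integrable f (μ[|s]) :=
  hf.restrict.smul_measure
    (ENNReal.inv_ne_top.mpr fun h => by simp [measureReal_def, h] at hs)

variable [IsProbabilityMeasure μ]

theorem isProbabilityMeasure_cond {s : Set Ω} (hs : 0 < μ.real s) :
    IsProbabilityMeasure (μ[|s]) :=
  cond_isProbabilityMeasure fun h => by simp [measureReal_def, h] at hs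

/-- Conditioning on a sequence of events that decreases in probability to an event `s` contained
in them is asymptotically the same as conditioning on `s`. -/
theorem tendsto_integral_cond_sub {A : ℕ → Set Ω} {s : Set Ω} (hs : MeasurableSet s)
    (hsA : ∀ n, s ⊆ A n) (hs0 : 0 < μ.real s)
    (hlim : Tendsto (fun n => μ.real (A n)) atTop (𝓝 (μ.real s))) {f : ℕ → Ω → ℝ} {M : ℝ}
    (hf : ∀ n, Measurable (f n)) (hM : ∀ n ω, ‖f n ω‖ ≤ M) :
    Tendsto (fun n => ∫ ω, f n ω ∂μ[|A n] - ∫ ω, f n ω ∂μ[|s]) atTop (𝓝 0) := by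
  have hint : ∀ n, Integrable (f n) μ := fun n =>
    Integrable.of_bound (hf n).aestronglyMeasurable M (Eventually.of_forall (hM n))
  have hM0 : 0 ≤ M := by
    have : Nonempty Ω := by
      by_contra h
      rw [not_nonempty_iff] at h
      simp [Set.eq_empty_of_isEmpty s] at hs0
    exact (norm_nonneg _).trans (hM 0 (Classical.arbitrary Ω))
  have hA0 : ∀ n, 0 < μ.real (A n) := fun n => hs0.trans_le (measureReal_mono (hsA n))
  have hle : ∀ n, |∫ ω, f n ω ∂μ[|A n] - ∫ ω, f n ω ∂μ[|s]|
      ≤ 2 * M * ((μ.real (A n) - μ.real s) / μ.real s) := by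
    intro n
    set a := μ.real (A n) with ha
    set p := μ.real s with hp
    have hpa : p ≤ a := measureReal_mono (hsA n)
    have ha0 : 0 < a := hA0 n
    have hsplit : ∫ ω in A n, f n ω ∂μ = ∫ ω in s, f n ω ∂μ + ∫ ω in A n \ s, f n ω ∂μ := by
      have := setIntegral_sdiff hs (hint n).integrableOn (hsA n)
      linarith
    have h1 : |∫ ω in A n \ s, f n ω ∂μ| ≤ M * (a - p) := by
      have h2 := norm_setIntegral_le_of_norm_le_const (μ := μ) (s := A n \ s) (measure_lt_top _ _)
        fun ω _ => hM n ω
      rwa [Real.norm_eq_abs, measureReal_sdiff (hsA n) hs] at h2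
    have h3 : |∫ ω in s, f n ω ∂μ| ≤ M * p :=
      norm_setIntegral_le_of_norm_le_const (measure_lt_top _ _) fun ω _ => hM n ω
    rw [integral_cond, integral_cond, hsplit, smul_eq_mul, smul_eq_mul]
    have h4 : a⁻¹ * (∫ ω in s, f n ω ∂μ + ∫ ω in A n \ s, f n ω ∂μ) - p⁻¹ * ∫ ω in s, f n ω ∂μ
        = a⁻¹ * (∫ ω in A n \ s, f n ω ∂μ) - (a - p) / (a * p) * ∫ ω in s, f n ω ∂μ := by
      field_simp
      ring
    rw [h4]
    have h5 : 0 ≤ a - p := by linarith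
    have h6 : 0 ≤ (a - p) / (a * p) := by positivity
    calc _ ≤ |a⁻¹ * (∫ ω in A n \ s, f n ω ∂μ)| + |(a - p) / (a * p) * ∫ ω in s, f n ω ∂μ| :=
          abs_sub _ _
      _ = a⁻¹ * |∫ ω in A n \ s, f n ω ∂μ| + (a - p) / (a * p) * |∫ ω in s, f n ω ∂μ| := by
          rw [abs_mul, abs_mul, abs_of_pos (inv_pos.mpr ha0), abs_of_nonneg h6]
      _ ≤ a⁻¹ * (M * (a - p)) + (a - p) / (a * p) * (M * p) := by gcongr
      _ = 2 * M * ((a - p) / a) := by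
          field_simp
          ring
      _ ≤ _ := by gcongr
  rw [tendsto_zero_iff_abs_tendsto_zero]
  refine squeeze_zero (fun n => abs_nonneg _) hle ?_
  have h1 : Tendsto (fun n => 2 * M * ((μ.real (A n) - μ.real s) / μ.real s)) atTop
      (𝓝 (2 * M * ((μ.real s - μ.real s) / μ.real s))) :=
    ((hlim.sub_const _).div_const _).const_mul _
  simpa using h1

end Conditioning

/-! ### The normalized urn -/

namespace PolyaUrn

variable {q : ℕ} {U : PolyaUrn q}
  {Ω : Type*} [MeasurableSpace Ω] {μ : Measure Ω}
  {X : ℕ → Ω → EuclideanSpace ℝ (Fin q)} {v : EuclideanSpace ℝ (Fin q)} {b : ℝ}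

theorem measurable_normalized (hX : U.IsUrnEvolution μ X) (n : ℕ) :
    Measurable (U.normalized μ X n) := by
  have := hX.measurable n
  unfold normalized
  fun_prop

variable [IsProbabilityMeasure μ]

theorem integrable_normalized_pow (hX : U.IsUrnEvolution μ X) (ht : IsTenable μ X)
    (hmom : ∀ i (k : ℕ), Integrable (fun y => ‖y‖ ^ k)
      (U.replacement i : Measure (EuclideanSpace ℝ (Fin q)))) (n k : ℕ) :
    Integrable (fun ω => ‖U.normalized μ X n ω‖ ^ k) μ := by
  simp only [normalized, norm_smul, mul_pow]
  exact (integrable_dist_pow (Λ := ContinuousLinearMap.id ℝ _) hX ht hmom n k _).const_mul _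

/-- The normalized compositions have bounded conditional moments. By Jensen's inequality the
distance of the conditional mean from the line `n ↦ n b v` obeys the same bound as the
composition, so centring at the mean costs only a constant factor. -/
theorem exists_normalized_moment_bound (hX : U.IsUrnEvolution μ X) (ht : IsTenable μ X)
    (hmom : ∀ i (k : ℕ), Integrable (fun y => ‖y‖ ^ k)
      (U.replacement i : Measure (EuclideanSpace ℝ (Fin q))))
    (hbound : ∀ m : ℕ, ∃ K : ℝ, 0 ≤ K ∧ ∀ n : ℕ,
      ∫ ω in X n ⁻¹' U.activeCompositions, ‖X n ω - ((n + 1) * b) • v‖ ^ (2 * m) ∂μ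
        ≤ K * (n + 1) ^ m)
    {D : ℕ → Set Ω} (hDsub : ∀ n, D n ⊆ U.nonExtinctUpTo X n) {p : ℝ} (hp : 0 < p)
    (hpD : ∀ n, p ≤ μ.real (D n)) (m : ℕ) :
    ∃ C : ℝ, ∀ n, ∫ ω, ‖U.normalized μ X n ω‖ ^ (2 * m) ∂μ[|D n] ≤ C := by
  obtain ⟨K, hK, hKn⟩ := hbound m
  have hDpos : ∀ n, 0 < μ.real (D n) := fun n => hp.trans_le (hpD n)
  have hprobD : ∀ n, IsProbabilityMeasure (μ[|D n]) := fun n => isProbabilityMeasure_cond (hDpos n)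
  have hEpos : ∀ n, 0 < μ.real (U.nonExtinctUpTo X n) := fun n =>
    (hDpos n).trans_le (measureReal_mono (hDsub n))
  have hprobE : ∀ n, IsProbabilityMeasure (μ[|U.nonExtinctUpTo X n]) := fun n =>
    isProbabilityMeasure_cond (hEpos n)
  have hint : ∀ n (z : EuclideanSpace ℝ (Fin q)), Integrable (fun ω => ‖X n ω - z‖ ^ (2 * m)) μ :=
    fun n z => integrable_dist_pow (Λ := ContinuousLinearMap.id ℝ _) hX ht hmom n (2 * m) z
  have hXint : ∀ n, Integrable (X n) μ := fun n =>
    (integrable_norm_iff (hX.measurable n).aestronglyMeasurable).mp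
      (by simpa using integrable_composition_pow hX ht hmom n 1)
  -- the bound around the line under any conditioning on an event of probability at least `p`
  have hline : ∀ n (s : Set Ω), s ⊆ U.nonExtinctUpTo X n → p ≤ μ.real s →
      ∫ ω, ‖X n ω - ((n + 1) * b) • v‖ ^ (2 * m) ∂μ[|s] ≤ p⁻¹ * (K * (n + 1) ^ m) := by
    intro n s hs hps
    rw [integral_cond, smul_eq_mul]
    gcongr
    refine le_trans ?_ (hKn n)
    rw [← setIntegral_congr_set (nonExtinctUpTo_ae_eq hX ht n)]
    exact setIntegral_mono_set (hint n _).integrableOn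
      (Eventually.of_forall fun ω => by positivity) (Eventually.of_forall hs)
  refine ⟨max 1 (2 ^ (2 * m - 1) * (2 * (p⁻¹ * (K * 2 ^ m)))), fun n => ?_⟩
  rcases Nat.eq_zero_or_pos n with rfl | hn
  · refine le_trans ?_ (le_max_left _ _)
    have h0 : ∀ ω, U.normalized μ X 0 ω = 0 := fun ω => by simp [normalized]
    simp only [h0, norm_zero, integral_const, probReal_univ, one_smul]
    exact pow_le_one₀ le_rfl zero_le_one
  · refine le_trans ?_ (le_max_right _ _)
    have hn0 : (0 : ℝ) < n := Nat.cast_pos.mpr hn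
    have hn1 : (1 : ℝ) ≤ n := Nat.one_le_cast.mpr hn
    set c := (((n : ℝ) + 1) * b) • v with hc
    set e := ∫ ω', X n ω' ∂μ[|U.nonExtinctUpTo X n] with he
    have hI : Integrable (fun ω => X n ω - c) (μ[|U.nonExtinctUpTo X n]) :=
      integrable_cond (hEpos n) ((hXint n).sub (integrable_const c))
    have hec : ‖e - c‖ ^ (2 * m) ≤ p⁻¹ * (K * (n + 1) ^ m) := by
      have h1 : e - c = ∫ ω, (X n ω - c) ∂μ[|U.nonExtinctUpTo X n] := by
        rw [integral_sub (integrable_cond (hEpos n) (hXint n)) (integrable_const _),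
          integral_const, probReal_univ, one_smul]
      have hconv : ConvexOn ℝ Set.univ
          fun x : EuclideanSpace ℝ (Fin q) => ‖x‖ ^ (2 * m) :=
        convexOn_univ_norm.pow (fun x _ => norm_nonneg x) _
      have h2 := hconv.map_integral_le (by fun_prop) isClosed_univ
        (Eventually.of_forall fun ω => Set.mem_univ (X n ω - c)) hI
        (integrable_cond (hEpos n) (hint n c))
      rw [h1]
      exact h2.trans (hline n _ subset_rfl ((hpD n).trans (measureReal_mono (hDsub n))))
    have hsq : ((√(n : ℝ))⁻¹) ^ (2 * m) = ((n : ℝ) ^ m)⁻¹ := by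
      rw [inv_pow, pow_mul, Real.sq_sqrt hn0.le]
    have hJ : Integrable (fun ω => ‖X n ω - c‖ ^ (2 * m)) (μ[|D n]) :=
      integrable_cond (hDpos n) (hint n c)
    calc ∫ ω, ‖U.normalized μ X n ω‖ ^ (2 * m) ∂μ[|D n]
        ≤ ∫ ω, ((n : ℝ) ^ m)⁻¹ * (2 ^ (2 * m - 1) *
            (‖X n ω - c‖ ^ (2 * m) + ‖e - c‖ ^ (2 * m))) ∂μ[|D n] := by
          refine integral_mono
            (integrable_cond (hDpos n) (integrable_normalized_pow hX ht hmom n _))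
            (((hJ.add (integrable_const _)).const_mul _).const_mul _) fun ω => ?_
          simp only [normalized, norm_smul, mul_pow, norm_inv, Real.norm_of_nonneg
            (Real.sqrt_nonneg _), hsq]
          gcongr
          calc ‖X n ω - e‖ ^ (2 * m) ≤ (‖X n ω - c‖ + ‖e - c‖) ^ (2 * m) := by
                gcongr
                rw [show X n ω - e = (X n ω - c) - (e - c) by abel]
                exact norm_sub_le _ _
            _ ≤ _ := add_pow_le (norm_nonneg _) (norm_nonneg _) _
      _ = ((n : ℝ) ^ m)⁻¹ * (2 ^ (2 * m - 1) *
            (∫ ω, ‖X n ω - c‖ ^ (2 * m) ∂μ[|D n] + ‖e - c‖ ^ (2 * m))) := by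
          rw [integral_const_mul, integral_const_mul, integral_add hJ (integrable_const _),
            integral_const, probReal_univ, one_smul]
      _ ≤ ((n : ℝ) ^ m)⁻¹ * (2 ^ (2 * m - 1) * (2 * (p⁻¹ * (K * (2 * n) ^ m)))) := by
          have h3 : p⁻¹ * (K * ((n : ℝ) + 1) ^ m) ≤ p⁻¹ * (K * (2 * n) ^ m) := by
            gcongr
            linarith
          have h4 := hline n (D n) (hDsub n) (hpD n)
          gcongr
          linarith
      _ = _ := by
          rw [mul_pow]
          field_simp

end PolyaUrn

theorem integral_coord_mul_multivariateGaussian {q : ℕ} {Sig : Matrix (Fin q) (Fin q) ℝ}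
    (hSig : Sig.PosSemidef) (i j : Fin q) :
    ∫ x, x i * x j ∂multivariateGaussian 0 Sig = Sig i j := by
  rw [← covariance_eval_multivariateGaussian (μ := 0) hSig i j, covariance]
  have h0 : ∀ i, ∫ x, x i ∂multivariateGaussian 0 Sig = 0 := by
    intro i
    have h1 := (EuclideanSpace.proj (𝕜 := ℝ) i).integral_comp_comm
      (IsGaussian.integrable_id (μ := multivariateGaussian 0 Sig))
    simp only [id] at h1
    rw [integral_id_multivariateGaussian] at h1
    exact h1
  simp only [h0, sub_zero]

theorem mainTheorem1 {q : ℕ} (hq : 2 ≤ q) (U : PolyaUrn q)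
    {Ω : Type*} [MeasurableSpace Ω] (μ : Measure Ω) [IsProbabilityMeasure μ]
    (X : ℕ → Ω → EuclideanSpace ℝ (Fin q)) (hX : U.IsUrnEvolution μ X)
    (ev : Fin q → ℂ) (hev : U.IsEigenvalueOrdering ev) (b : ℝ)
    (hU : ∀ p : ℝ, 2 ≤ p → U.StandingCondition (by omega) μ X ev b p)
    (hsmall : 2 * (ev ⟨1, by omega⟩).re < b)
    (Sig : Matrix (Fin q) (Fin q) ℝ) (hSig : Sig.PosSemidef)
    (hCLT : CondTendstoNormal μ (U.nonExtinctUpTo X) (U.normalized μ X) Sig ∨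
      CondTendstoNormal μ (fun _ => U.nonExtinct X) (U.normalized μ X) Sig) :
    (CondTendstoNormal μ (U.nonExtinctUpTo X) (U.normalized μ X) Sig ∧
      CondMomentsTendstoNormal μ (U.nonExtinctUpTo X) (U.normalized μ X) Sig) ∧
    (CondTendstoNormal μ (fun _ => U.nonExtinct X) (U.normalized μ X) Sig ∧
      CondMomentsTendstoNormal μ (fun _ => U.nonExtinct X) (U.normalized μ X) Sig) ∧
    ∀ i j, Tendsto
      (fun n : ℕ => cov[fun ω => X n ω i, fun ω => X n ω j; μ[|U.nonExtinctUpTo X n]] / n)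
      atTop (𝓝 (Sig i j)) := by
  have hstand := hU 2 le_rfl
  have ht := hstand.tenable
  have hmom : ∀ i (k : ℕ), Integrable (fun y => ‖y‖ ^ k)
      (U.replacement i : Measure (EuclideanSpace ℝ (Fin q))) := by
    intro i k
    have h1 := (hU (max 2 k) (le_max_left _ _)).memLp i
    refine (h1.mono_exponent (p := (k : ENNReal)) ?_).integrable_norm_pow'
    rw [← ENNReal.ofReal_natCast]
    exact ENNReal.ofReal_le_ofReal (le_max_right _ _)
  obtain ⟨v, hv, hbound⟩ := PolyaUrn.exists_moment_bound_norm rfl rfl hX ht hev hstand.balanced hmom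
    hstand.first_eigenvalue hsmall
  have hpos := PolyaUrn.measureReal_nonExtinct_pos hX ht hstand.balanced hmom hv hbound
  have hsub : ∀ n, U.nonExtinct X ⊆ U.nonExtinctUpTo X n := fun n => Set.iInter_subset _ n
  have hle : ∀ n, μ.real (U.nonExtinct X) ≤ μ.real (U.nonExtinctUpTo X n) := fun n =>
    measureReal_mono (hsub n)
  have hYm := PolyaUrn.measurable_normalized (U := U) hX
  -- the two conditionings are asymptotically equivalent
  have hdiff : ∀ f : EuclideanSpace ℝ (Fin q) →ᵇ ℝ,
      Tendsto (fun n => ∫ ω, f (U.normalized μ X n ω) ∂μ[|U.nonExtinctUpTo X n]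
        - ∫ ω, f (U.normalized μ X n ω) ∂μ[|U.nonExtinct X]) atTop (𝓝 0) := fun f =>
    tendsto_integral_cond_sub (PolyaUrn.measurableSet_nonExtinct hX) hsub hpos
      (PolyaUrn.tendsto_measureReal_nonExtinctUpTo hX)
      (fun n => f.continuous.measurable.comp (hYm n)) fun n ω => f.norm_coe_le_norm _
  have hboth : CondTendstoNormal μ (U.nonExtinctUpTo X) (U.normalized μ X) Sig ∧
      CondTendstoNormal μ (fun _ => U.nonExtinct X) (U.normalized μ X) Sig := by
    rcases hCLT with h | h
    · exact ⟨h, fun f => by simpa using (h f).sub (hdiff f)⟩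
    · exact ⟨fun f => by simpa using (hdiff f).add (h f), h⟩
  have hbound' : ∀ m : ℕ, ∃ K : ℝ, 0 ≤ K ∧ ∀ n : ℕ,
      ∫ ω in X n ⁻¹' U.activeCompositions, ‖X n ω - ((n + 1) * b) • v‖ ^ (2 * m) ∂μ
        ≤ K * (n + 1) ^ m := fun m => by
    obtain ⟨K, hK, hKn⟩ := hbound m
    exact ⟨K, hK, fun n => (hKn n).1⟩
  have hEpos : ∀ n, 0 < μ.real (U.nonExtinctUpTo X n) := fun n => hpos.trans_le (hle n)
  have hprobE : ∀ n, IsProbabilityMeasure (μ[|U.nonExtinctUpTo X n]) := fun n =>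
    isProbabilityMeasure_cond (hEpos n)
  have hYint := PolyaUrn.integrable_normalized_pow (U := U) hX ht hmom
  have hYintE : ∀ n (k : ℕ), Integrable (fun ω => ‖U.normalized μ X n ω‖ ^ k)
      (μ[|U.nonExtinctUpTo X n]) := fun n k => integrable_cond (hEpos n) (hYint n k)
  have hYE := PolyaUrn.exists_normalized_moment_bound hX ht hmom hbound' (fun n => subset_rfl)
    hpos hle
  have hYD := PolyaUrn.exists_normalized_moment_bound hX ht hmom hbound' hsub hpos
    fun _ => le_rfl
  refine ⟨⟨hboth.1, hboth.1.condMomentsTendstoNormal hprobE hYm hYintE hYE⟩,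
    ⟨hboth.2, hboth.2.condMomentsTendstoNormal (fun _ => isProbabilityMeasure_cond hpos) hYm
      (fun n k => integrable_cond hpos (hYint n k)) hYD⟩, fun i j => ?_⟩
  have hlim := hboth.1.tendsto_integral hprobE hYm hYintE hYE (g := fun x => x i * x j)
    (by fun_prop) (C := 1) (k := 2) fun x => by
      rw [norm_mul, one_mul, sq]
      have h1 : ∀ i, ‖x i‖ ≤ 1 + ‖x‖ := fun i =>
        (PiLp.norm_apply_le x i).trans (by linarith)
      exact mul_le_mul (h1 i) (h1 j) (norm_nonneg _) (by positivity)
  rw [integral_coord_mul_multivariateGaussian hSig] at hlim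
  refine hlim.congr' ?_
  filter_upwards [eventually_gt_atTop 0] with n hn
  have hn0 : (0 : ℝ) < n := Nat.cast_pos.mpr hn
  have hXint : Integrable (X n) (μ[|U.nonExtinctUpTo X n]) := integrable_cond (hEpos n)
    ((integrable_norm_iff (hX.measurable n).aestronglyMeasurable).mp
      (by simpa using PolyaUrn.integrable_composition_pow hX ht hmom n 1))
  have hmean : ∀ i, (∫ ω, X n ω ∂μ[|U.nonExtinctUpTo X n]) i
      = ∫ ω, X n ω i ∂μ[|U.nonExtinctUpTo X n] := fun i =>
    ((EuclideanSpace.proj (𝕜 := ℝ) i).integral_comp_comm hXint).symm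
  rw [covariance, ← integral_div]
  refine integral_congr_ae (Eventually.of_forall fun ω => ?_)
  simp only [PolyaUrn.normalized, PiLp.smul_apply, PiLp.sub_apply, hmean, smul_eq_mul]
  have hs : (√(n : ℝ))⁻¹ * (√(n : ℝ))⁻¹ = (n : ℝ)⁻¹ := by
    rw [← mul_inv, Real.mul_self_sqrt hn0.le]
  rw [mul_mul_mul_comm, hs, div_eq_inv_mul]
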